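/- **Theorem (Kirchhoff–Love power balance, Stokes–Dirac case).** Let $\Omega\subset\mathbb R^2$ be a bounded open set with Lipschitz boundary, with unit outward normal $\bm n$ and arc length $\mathrm ds$ on $\partial\Omega$. Let $\rho,h>0$ be measurable functions on $\Omega$ with $\rho h$ bounded below by a positive constant, and let $\mathbb D=(D_{ijkl})$ be a bounded measurable tensor field on $\Omega$ with $D_{ijkl}=D_{klij}=D_{jikl}$ (in particular, constants $\rho,h>0$ and a constant such $\mathbb D$ are allowed). Write $(\mathbf{Grad}\,\bm u)_{ij}=\frac12(\partial_j u_i+\partial_i u_j)$ and $(\mathbf{Div}\,T)_i=\sum_j\partial_j T_{ij}$, all derivatives being weak derivatives in $L^2(\Omega)$. Let $I\subset\mathbb R$ be an interval, let $p_w:\mathbb{R}\to L^2(\Omega)$ and $\varepsilon_\phi:\mathbb{R}\to L^2(\Omega)^{2\times2}$ be differentiable on $I$ (one-sidedly at end points of $I$ that belong to $I$) as $L^2$-valued functions, with $\varepsilon_\phi(t)$ symmetric for $t\in I$. Assume that, for every $t\in I$, the fields $$v=\tfrac1{\rho h}\,p_w,\qquad \sigma_\phi=\mathbb D\,\varepsilon_\phi,\qquad\text{i.e.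 } (\sigma_\phi)_{ij}=\sum_{k,l}D_{ijkl}(\varepsilon_\phi)_{kl},$$ and the Lagrange multipliers $\bm\omega,\bm N$ have all their components in $H^1(\Omega)$ and satisfy the constrained first-order system $$\partial_t p_w=\operatorname{div}\bm N,\qquad \partial_t\varepsilon_\phi=\mathbf{Grad}(\bm\omega),\qquad 0=\mathbf{Div}(\sigma_\phi)+\bm N,\qquad 0=\mathbf{grad}(v)-\bm\omega .$$ Let $$H_{KL}^{SD}=\frac12\int_\Omega \frac1{\rho h}\,p_w^2+\varepsilon_\phi:\mathbb D\,\varepsilon_\phi\,\mathrm dx .$$ Then, for every $t\in I$, the function $t\mapsto H^{SD}_{KL}(p_w(t),\varepsilon_\phi(t))$ is differentiable at $t$ (one-sidedly at end points of $I$), and $$\frac{\mathrm d}{\mathrm dt}H_{KL}^{SD}=\int_{\partial\Omega}-\,v\,\mathbf{Div}(\sigma_\phi)\cdot\bm n+\mathbf{grad}(v)^\top\sigma_\phi\,\bm n\,\mathrm ds ,$$ where $v$, $\mathbf{Div}(\sigma_\phi)$, $\mathbf{grad}(v)$ and $\sigma_\phi$ stand for their boundary traces on $\partial\Omega$, and the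 integrand is integrable. -/

import Mathlib

open MeasureTheory Filter Topology
open scoped ENNReal

noncomputable section

namespace KirchhoffLove

/-- The Euclidean plane. -/
abbrev Plane : Type := EuclideanSpace ℝ (Fin 2)

/-- `L²(Ω)`, with Lebesgue measure. -/
abbrev L2 (Ω : Set Plane) : Type := Lp ℝ 2 ((volume : Measure Plane).restrict Ω)

/-- The arc length measure `ds` on `∂Ω`: one-dimensional Hausdorff measure. -/
def bdryMeasure (Ω : Set Plane) : Measure Plane :=
  (Measure.hausdorffMeasure 1 : Measure Plane).restrict (frontier Ω)

/-- `L²(∂Ω)`, with arc length measure. -/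
abbrev L2Bdry (Ω : Set Plane) : Type := Lp ℝ 2 (bdryMeasure Ω)

/-- Bounded open sets with Lipschitz boundary: in a ball around each boundary point, and in
suitable Cartesian coordinates, `Ω` is the region below the graph of a Lipschitz function. -/
structure IsLipschitzDomain (Ω : Set Plane) : Prop where
  isOpen : IsOpen Ω
  bounded : Bornology.IsBounded Ω
  graph : ∀ x ∈ frontier Ω, ∃ (e : Plane ≃ₗᵢ[ℝ] Plane) (f : ℝ → ℝ) (K : NNReal) (r : ℝ),
    LipschitzWith K f ∧ 0 < r ∧
      ∀ y ∈ Metric.ball x r, (y ∈ Ω ↔ (e y) 1 < f ((e y) 0))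

/-- `n` is the unit outward normal to `Ω` at `x`: near `x`, every open cone of directions
strictly inside the half-plane `⟪·, n⟫ < 0` lies in `Ω`, and every such cone in
`⟪·, n⟫ > 0` lies outside `Ω`. -/
def IsOuterNormal (Ω : Set Plane) (x n : Plane) : Prop :=
  ‖n‖ = 1 ∧ ∀ δ : ℝ, 0 < δ → ∀ᶠ y in 𝓝 x,
    (inner ℝ (y - x) n < -(δ * ‖y - x‖) → y ∈ Ω) ∧
    (δ * ‖y - x‖ < inner ℝ (y - x) n → y ∉ Ω)

open Classical in
/-- The unit outward normal field (with value `0` where there is no outward normal). -/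
def outerNormal (Ω : Set Plane) (x : Plane) : Plane :=
  if h : ∃ n, IsOuterNormal Ω x n then h.choose else 0

/-- The classical partial derivative `∂φ/∂xᵢ`. -/
def pderiv (i : Fin 2) (φ : Plane → ℝ) (x : Plane) : ℝ :=
  fderiv ℝ φ x (EuclideanSpace.single i 1)

/-- `g` is the weak partial derivative `∂u/∂xᵢ` in `Ω`. -/
def HasWeakPartial (Ω : Set Plane) (i : Fin 2) (u g : L2 Ω) : Prop :=
  ∀ φ : Plane → ℝ, ContDiff ℝ (⊤ : ℕ∞) φ → HasCompactSupport φ → tsupport φ ⊆ Ω →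
    ∫ x in Ω, u x * pderiv i φ x = -∫ x in Ω, g x * φ x

/-- `u ∈ H¹(Ω)`: both weak partial derivatives exist in `L²(Ω)`. -/
def MemH1 (Ω : Set Plane) (u : L2 Ω) : Prop :=
  ∀ i, ∃ g : L2 Ω, HasWeakPartial Ω i u g

open Classical in
/-- The weak partial derivative in `L²(Ω)` (with value `0` if there is none). -/
def weakPartial (Ω : Set Plane) (i : Fin 2) (u : L2 Ω) : L2 Ω :=
  if h : ∃ g, HasWeakPartial Ω i u g then h.choose else 0

/-- The gradient of a scalar field. -/
def grad (Ω : Set Plane) (u : L2 Ω) : Fin 2 → L2 Ω :=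
  fun i => weakPartial Ω i u

/-- The divergence of a vector field. -/
def vdiv (Ω : Set Plane) (u : Fin 2 → L2 Ω) : L2 Ω :=
  ∑ i, weakPartial Ω i (u i)

/-- The symmetric gradient of a vector field. -/
def symGrad (Ω : Set Plane) (u : Fin 2 → L2 Ω) : Fin 2 → Fin 2 → L2 Ω :=
  fun i j => (1 / 2 : ℝ) • (weakPartial Ω j (u i) + weakPartial Ω i (u j))

/-- The (row-wise) divergence of a tensor field. -/
def tensorDiv (Ω : Set Plane) (T : Fin 2 → Fin 2 → L2 Ω) : Fin 2 → L2 Ω :=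
  fun i => ∑ j, weakPartial Ω j (T i j)

/-- `g ∈ L²(∂Ω)` is the boundary trace of `u ∈ H¹(Ω)`: there are functions `Uₖ`, smooth on the
whole plane, with `Uₖ → u` in `H¹(Ω)` and `Uₖ → g` in `L²(∂Ω)`. -/
def IsTrace (Ω : Set Plane) (u : L2 Ω) (g : L2Bdry Ω) : Prop :=
  ∃ U : ℕ → Plane → ℝ, (∀ k, ContDiff ℝ (⊤ : ℕ∞) (U k)) ∧
    Tendsto (fun k => eLpNorm (fun x => U k x - u x) 2 (volume.restrict Ω)) atTop (𝓝 0) ∧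
    (∀ i, Tendsto (fun k => eLpNorm (fun x => pderiv i (U k) x - weakPartial Ω i u x) 2
      (volume.restrict Ω)) atTop (𝓝 0)) ∧
    Tendsto (fun k => eLpNorm (fun x => U k x - g x) 2 (bdryMeasure Ω)) atTop (𝓝 0)

open Classical in
/-- The trace on `∂Ω` of a function in `H¹(Ω)` (with value `0` if there is none). -/
def trace (Ω : Set Plane) (u : L2 Ω) : L2Bdry Ω :=
  if h : ∃ g, IsTrace Ω u g then h.choose else 0

/-- Standing properties of the material parameters of a plate: `ρ` (density), `h` (thickness)
and `D` (the fourth-order bending stiffness tensor `D i j k l`), which may vary over `Ω`. -/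
structure IsPlateMaterial (Ω : Set Plane) (ρ h : Plane → ℝ)
    (D : Fin 2 → Fin 2 → Fin 2 → Fin 2 → Plane → ℝ) : Prop where
  rho_meas : AEMeasurable ρ (volume.restrict Ω)
  h_meas : AEMeasurable h (volume.restrict Ω)
  D_meas : ∀ i j k l, AEMeasurable (D i j k l) (volume.restrict Ω)
  rho_pos : ∀ x ∈ Ω, 0 < ρ x
  h_pos : ∀ x ∈ Ω, 0 < h x
  lower : ∃ c : ℝ, 0 < c ∧ ∀ x ∈ Ω, c ≤ ρ x * h x
  D_bdd : ∃ C : ℝ, ∀ i j k l, ∀ x ∈ Ω, |D i j k l x| ≤ C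
  D_major : ∀ i j k l, ∀ x ∈ Ω, D i j k l x = D k l i j x
  D_minor : ∀ i j k l, ∀ x ∈ Ω, D i j k l x = D j i k l x

/-- The Hamiltonian `½ ∫_Ω (1/(ρh)) p² + ε : D ε dx`. -/
def hamiltonian (Ω : Set Plane) (ρ h : Plane → ℝ)
    (D : Fin 2 → Fin 2 → Fin 2 → Fin 2 → Plane → ℝ)
    (p : L2 Ω) (ε : Fin 2 → Fin 2 → L2 Ω) : ℝ :=
  (1 / 2) * ∫ x in Ω, (1 / (ρ x * h x) * (p x) ^ 2 +
    ∑ i, ∑ j, ε i j x * ∑ k, ∑ l, D i j k l x * ε k l x)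

/-- Solutions, on the set `I` of times, of the constrained first-order system
`∂ₜp = div N`, `∂ₜε = Grad ω`, `0 = Div σ + N`, `0 = grad v - ω`, with the constitutive relations
`v = p / (ρh)` and `σ = D ε`. Time derivatives are taken in `L²(Ω)` (one-sided at end points
of `I` that belong to `I`), and the variables to which the matrix of differential operators is
applied are in `H¹(Ω)`. -/
structure IsSolution (Ω : Set Plane) (ρ h : Plane → ℝ)
    (D : Fin 2 → Fin 2 → Fin 2 → Fin 2 → Plane → ℝ) (I : Set ℝ)
    (p : ℝ → L2 Ω) (ε : ℝ → Fin 2 → Fin 2 → L2 Ω)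
    (v : ℝ → L2 Ω) (σ : ℝ → Fin 2 → Fin 2 → L2 Ω) (ω N : ℝ → Fin 2 → L2 Ω) : Prop where
  eps_symm : ∀ t ∈ I, ∀ i j, ε t i j = ε t j i
  v_eq : ∀ t ∈ I, ∀ᵐ x ∂(volume.restrict Ω), v t x = 1 / (ρ x * h x) * p t x
  sigma_eq : ∀ t ∈ I, ∀ i j, ∀ᵐ x ∂(volume.restrict Ω),
    σ t i j x = ∑ k, ∑ l, D i j k l x * ε t k l x
  v_mem : ∀ t ∈ I, MemH1 Ω (v t)
  sigma_mem : ∀ t ∈ I, ∀ i j, MemH1 Ω (σ t i j)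
  omega_mem : ∀ t ∈ I, ∀ i, MemH1 Ω (ω t i)
  N_mem : ∀ t ∈ I, ∀ i, MemH1 Ω (N t i)
  momentum : ∀ t ∈ I, HasDerivWithinAt p (vdiv Ω (N t)) I t
  curvature : ∀ t ∈ I, HasDerivWithinAt ε (symGrad Ω (ω t)) I t
  constraint_N : ∀ t ∈ I, 0 = tensorDiv Ω (σ t) + N t
  constraint_omega : ∀ t ∈ I, 0 = grad Ω (v t) - ω t

/-- The boundary power density `-v Div(σ)·n + grad(v)ᵀ σ n` on `∂Ω`. -/
def boundaryPower (Ω : Set Plane) (v : L2 Ω) (σ : Fin 2 → Fin 2 → L2 Ω) (x : Plane) : ℝ :=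
  -(trace Ω v x * ∑ i, trace Ω (tensorDiv Ω σ i) x * outerNormal Ω x i) +
    ∑ i, ∑ j, trace Ω (grad Ω v i) x * trace Ω (σ i j) x * outerNormal Ω x j

end KirchhoffLove

end

/-! The Hamiltonian is a quadratic form with bounded, time-independent coefficients. By the major
symmetry of `D`, its time derivative is `∫ v ∂ₜp + σ : ∂ₜε = ∫ v div N + σ : Grad ω`
(`hasDerivWithinAt_hamiltonian`). The minor symmetry of `D` makes `σ` symmetric, so `σ : Grad ω = σ
: ∇ω`. Green's formula turns the two terms into `-∫ ∇v · N + ∮ v N · n` and `-∫ ω · Div σ + ∮ ω · σ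
n`. Since `∇v = ω` and `Div σ = -N`, the interior integrals cancel, and the same constraints give
the boundary integrals the stated form (`IsLipschitzDomain.integral_boundaryPower`).

The analytic weight lies in Green's formula for `H¹` functions on a Lipschitz domain
(`IsLipschitzDomain.green`). It rests on three facts, each local and glued by a partition of unity:
the divergence theorem for `C¹` functions, with Hausdorff measure and the a.e. normal on the
boundary (`IsLipschitzDomain.integral_fderiv`); the trace inequality
(`IsLipschitzDomain.exists_eLpNorm_le`); and density in `H¹` of functions smooth up to the boundary
(`IsLipschitzDomain.exists_smooth_approx`). The last two give existence of traces. Green's formula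
is proved for every pair of functions satisfying `IsTrace`, so the choice made in `trace` is
harmless and uniqueness of traces is not needed. -/

namespace KirchhoffLove

/-! ### Arc length of Lipschitz graphs -/

/-- The graph of `f : ℝ → ℝ` in the Cartesian coordinates `e`. -/
noncomputable def graphMap (e : Plane ≃ₗᵢ[ℝ] Plane) (f : ℝ → ℝ) (x : ℝ) : Plane :=
  e.symm !₂[x, f x]

section GraphMap

variable (e : Plane ≃ₗᵢ[ℝ] Plane) (f : ℝ → ℝ)

lemma graphMap_apply_zero (x : ℝ) : (e (graphMap e f x)) 0 = x := by
  simp [graphMap]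

lemma graphMap_apply_one (x : ℝ) : (e (graphMap e f x)) 1 = f x := by
  simp [graphMap]

lemma dist_graphMap (x y : ℝ) :
    dist (graphMap e f x) (graphMap e f y) = √((x - y) ^ 2 + (f x - f y) ^ 2) := by
  rw [graphMap, graphMap, LinearIsometryEquiv.dist_map, EuclideanSpace.dist_eq]
  simp [Fin.sum_univ_two, Real.dist_eq, sq_abs]

lemma mem_range_graphMap {y : Plane} :
    y ∈ Set.range (graphMap e f) ↔ (e y) 1 = f ((e y) 0) := by
  constructor
  · rintro ⟨x, rfl⟩
    rw [graphMap_apply_zero, graphMap_apply_one]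
  · intro h
    refine ⟨(e y) 0, ?_⟩
    rw [graphMap, LinearIsometryEquiv.symm_apply_eq]
    ext i
    fin_cases i
    · simp
    · simpa using h.symm

lemma continuous_graphMap {f : ℝ → ℝ} (hf : Continuous f) : Continuous (graphMap e f) := by
  unfold graphMap
  fun_prop

lemma measurableEmbedding_graphMap {f : ℝ → ℝ} (hf : Continuous f) :
    MeasurableEmbedding (graphMap e f) :=
  (continuous_graphMap e hf).measurableEmbedding fun x y h => by
    simpa [graphMap_apply_zero] using congrArg (fun p => (e p) 0) h

end GraphMap

/-- The function `m ↦ √(1 + m²)` is 1-Lipschitz: an error in the slope costs at most as much in the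
length element. -/
lemma sqrt_one_add_sq_le (a b : ℝ) : √(1 + a ^ 2) ≤ √(1 + b ^ 2) + |a - b| := by
  rw [Real.sqrt_le_left (by positivity)]
  have h1 := Real.sq_sqrt (show (0 : ℝ) ≤ 1 + b ^ 2 by positivity)
  have h2 : |b| ≤ √(1 + b ^ 2) := Real.abs_le_sqrt (by linarith)
  have h3 : a ≤ |b| + |a - b| := by cases abs_cases b <;> cases abs_cases (a - b) <;> linarith
  have h4 : -a ≤ |b| + |a - b| := by cases abs_cases b <;> cases abs_cases (a - b) <;> linarith
  have h5 : a ^ 2 ≤ (|b| + |a - b|) ^ 2 := sq_le_sq' (by linarith) h3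
  nlinarith [abs_nonneg (a - b), sq_abs b]

section Area

variable (e : Plane ≃ₗᵢ[ℝ] Plane) (f : ℝ → ℝ)

lemma dist_graphMap_le {q δ x y : ℝ}
    (h : |f x - f y - q * (x - y)| ≤ δ * |x - y|) :
    dist (graphMap e f x) (graphMap e f y) ≤ (√(1 + q ^ 2) + δ) * |x - y| := by
  rcases eq_or_ne x y with rfl | hxy
  · simp
  have hp : 0 < |x - y| := abs_pos.2 (sub_ne_zero.2 hxy)
  set m := (f x - f y) / (x - y) with hm
  have hxy' := sub_ne_zero.2 hxy
  have hfm : f x - f y = m * (x - y) := by rw [hm]; field_simp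
  have hmq : |m - q| ≤ δ := by
    rw [hfm, ← sub_mul, abs_mul] at h
    exact le_of_mul_le_mul_right h hp
  rw [dist_graphMap, hfm, show (x - y) ^ 2 + (m * (x - y)) ^ 2 = (1 + m ^ 2) * (x - y) ^ 2 by ring,
    Real.sqrt_mul (by positivity), Real.sqrt_sq_eq_abs]
  gcongr
  linarith [sqrt_one_add_sq_le m q]

lemma le_dist_graphMap {q δ x y : ℝ}
    (h : |f x - f y - q * (x - y)| ≤ δ * |x - y|) :
    (√(1 + q ^ 2) - δ) * |x - y| ≤ dist (graphMap e f x) (graphMap e f y) := by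
  rcases eq_or_ne x y with rfl | hxy
  · simp
  have hp : 0 < |x - y| := abs_pos.2 (sub_ne_zero.2 hxy)
  set m := (f x - f y) / (x - y) with hm
  have hxy' := sub_ne_zero.2 hxy
  have hfm : f x - f y = m * (x - y) := by rw [hm]; field_simp
  have hmq : |m - q| ≤ δ := by
    rw [hfm, ← sub_mul, abs_mul] at h
    exact le_of_mul_le_mul_right h hp
  rw [dist_graphMap, hfm, show (x - y) ^ 2 + (m * (x - y)) ^ 2 = (1 + m ^ 2) * (x - y) ^ 2 by ring,
    Real.sqrt_mul (by positivity), Real.sqrt_sq_eq_abs]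
  gcongr
  have := sqrt_one_add_sq_le q m
  rw [abs_sub_comm] at this
  linarith

lemma hausdorffMeasure_graphMap_image_le {q δ : ℝ} (hδ : 0 ≤ δ) {A : Set ℝ}
    (h : ∀ x ∈ A, ∀ y ∈ A, |f x - f y - q * (x - y)| ≤ δ * |x - y|) :
    (Measure.hausdorffMeasure 1 : Measure Plane) (graphMap e f '' A) ≤
      ENNReal.ofReal (√(1 + q ^ 2) + δ) * volume A := by
  have hl : LipschitzOnWith (Real.toNNReal (√(1 + q ^ 2) + δ)) (graphMap e f) A := by
    refine LipschitzOnWith.of_dist_le_mul fun x hx y hy => ?_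
    rw [Real.coe_toNNReal _ (by positivity), Real.dist_eq]
    exact dist_graphMap_le e f (h x hx y hy)
  have := hl.hausdorffMeasure_image_le (d := 1) zero_le_one
  rwa [ENNReal.rpow_one, hausdorffMeasure_real] at this

/-- The first coordinate inverts the graph map, and on the graph over `A` it is Lipschitz with
constant `1/c`. The bound `δ < 1` keeps `c` positive, because `√(1 + q²) ≥ 1`. -/
lemma le_hausdorffMeasure_graphMap_image {q δ : ℝ} (hδ1 : δ < 1) {A : Set ℝ}
    (h : ∀ x ∈ A, ∀ y ∈ A, |f x - f y - q * (x - y)| ≤ δ * |x - y|) :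
    ENNReal.ofReal (√(1 + q ^ 2) - δ) * volume A ≤
      (Measure.hausdorffMeasure 1 : Measure Plane) (graphMap e f '' A) := by
  set c := √(1 + q ^ 2) - δ with hc
  have h1 : 1 ≤ √(1 + q ^ 2) := Real.one_le_sqrt.2 (by nlinarith [sq_nonneg q])
  have hc0 : 0 < c := by linarith
  have hl : LipschitzOnWith (Real.toNNReal c⁻¹) (fun p : Plane => (e p) 0) (graphMap e f '' A) := by
    refine LipschitzOnWith.of_dist_le_mul ?_
    rintro _ ⟨x, hx, rfl⟩ _ ⟨y, hy, rfl⟩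
    rw [Real.coe_toNNReal _ (by positivity)]
    simp only [graphMap_apply_zero, Real.dist_eq]
    have := le_dist_graphMap e f (h x hx y hy)
    rw [inv_mul_eq_div, le_div_iff₀ hc0]
    linarith
  have := hl.hausdorffMeasure_image_le (d := 1) zero_le_one
  rw [ENNReal.rpow_one, hausdorffMeasure_real, Set.image_image] at this
  simp only [graphMap_apply_zero, Set.image_id'] at this
  calc _ ≤ ENNReal.ofReal c * (ENNReal.ofReal c⁻¹ * _) := by gcongr; exact this
    _ = _ := by
      rw [← mul_assoc, ← ENNReal.ofReal_mul hc0.le, mul_inv_cancel₀ hc0.ne', ENNReal.ofReal_one,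
        one_mul]

end Area

lemma measure_le_of_disjoint_cover {α : Type*} [MeasurableSpace α] {μ ν : Measure α}
    {T : ℕ → Set α} (hd : Pairwise (Function.onFun Disjoint T)) (hT : ∀ n, MeasurableSet (T n))
    (h0 : μ (⋃ n, T n)ᶜ = 0) (h : ∀ n A, MeasurableSet A → A ⊆ T n → μ A ≤ ν A) : μ ≤ ν := by
  refine Measure.le_iff.2 fun A hA => ?_
  have hd' : Pairwise (Function.onFun Disjoint fun n => A ∩ T n) := fun i j hij =>
    (hd hij).mono Set.inter_subset_right Set.inter_subset_right
  calc μ A ≤ μ (A ∩ ⋃ n, T n) + μ (⋃ n, T n)ᶜ := by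
        refine (measure_mono fun x hx => ?_).trans (measure_union_le _ _)
        by_cases hx' : x ∈ ⋃ n, T n
        · exact Or.inl ⟨hx, hx'⟩
        · exact Or.inr hx'
    _ = ∑' n, μ (A ∩ T n) := by
        rw [h0, add_zero, Set.inter_iUnion, measure_iUnion hd' fun n => hA.inter (hT n)]
    _ ≤ ∑' n, ν (A ∩ T n) :=
        ENNReal.tsum_le_tsum fun n => h n _ (hA.inter (hT n)) Set.inter_subset_right
    _ = ν (⋃ n, A ∩ T n) := (measure_iUnion hd' fun n => hA.inter (hT n)).symm
    _ ≤ ν A := measure_mono (Set.iUnion_subset fun n => Set.inter_subset_left)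

/-- Letting `δ → 0` removes the error term only on sets of finite volume, hence the passage through
spanning sets. -/
lemma measure_eq_of_forall_le_add {μ ν : Measure ℝ}
    (h1 : ∀ δ : ℝ, 0 < δ → δ < 1 → μ ≤ ν + ENNReal.ofReal δ • volume)
    (h2 : ∀ δ : ℝ, 0 < δ → δ < 1 → ν ≤ μ + ENNReal.ofReal δ • volume) : μ = ν := by
  have key : ∀ {μ ν : Measure ℝ} (_ : ∀ δ : ℝ, 0 < δ → δ < 1 → μ ≤ ν + ENNReal.ofReal δ • volume)
      {A : Set ℝ}, volume A ≠ ∞ → μ A ≤ ν A := by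
    intro μ ν h A hA
    have ht : Tendsto (fun δ : ℝ => ν A + ENNReal.ofReal δ * volume A) (𝓝[>] 0) (𝓝 (ν A)) := by
      have : Tendsto (fun δ : ℝ => ENNReal.ofReal δ * volume A) (𝓝[>] 0)
          (𝓝 (ENNReal.ofReal 0 * volume A)) :=
        ENNReal.Tendsto.mul_const ((ENNReal.continuous_ofReal.tendsto 0).mono_left
          nhdsWithin_le_nhds) (Or.inr hA)
      simpa using this.const_add (ν A)
    refine ge_of_tendsto ht ?_
    filter_upwards [Ioo_mem_nhdsGT (zero_lt_one (α := ℝ))] with δ hδ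
    simpa using h δ hδ.1 hδ.2 A
  refine (Measure.ext_iff_of_iUnion_eq_univ (iUnion_spanningSets (volume : Measure ℝ))).2
    fun n => ?_
  ext A hA
  rw [Measure.restrict_apply hA, Measure.restrict_apply hA]
  have : volume (A ∩ spanningSets (volume : Measure ℝ) n) ≠ ∞ :=
    ((measure_mono Set.inter_subset_right).trans_lt (measure_spanningSets_lt_top _ n)).ne
  exact le_antisymm (key h1 this) (key h2 this)

section AreaFormula

variable (e : Plane ≃ₗᵢ[ℝ] Plane) {f : ℝ → ℝ} {K : NNReal}

/-- Up to a null set, the line splits into countably many pieces on which `f` is within `δ` of a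
linear function in the Lipschitz sense. On a piece of slope `q` the graph map distorts lengths by
factors between `√(1 + q²) - δ` and `√(1 + q²) + δ`, while `f'` is a.e. within `δ` of `q`. Both
measures are thus compared up to a multiple of `δ` times volume. -/
lemma comap_graphMap_hausdorffMeasure (hf : LipschitzWith K f) :
    Measure.comap (graphMap e f) (Measure.hausdorffMeasure 1 : Measure Plane) =
      volume.withDensity fun x => ENNReal.ofReal (√(1 + deriv f x ^ 2)) := by
  have hemb := measurableEmbedding_graphMap e hf.continuous
  set G : Set ℝ := {x | DifferentiableAt ℝ f x} with hG
  have hGm : MeasurableSet G := measurableSet_of_differentiableAt ℝ f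
  have hGn : volume Gᶜ = 0 := hf.ae_differentiableAt_real
  have hlip : ∀ x y, |f x - f y - 0 * (x - y)| ≤ K * |x - y| := fun x y => by
    simpa [Real.dist_eq] using hf.dist_le_mul x y
  -- Slope `0` with error `K` is a global approximation of `f`; it shows that null sets have null
  -- image, so the exceptional set can be discarded.
  have hac : ∀ A : Set ℝ, volume A = 0 →
      Measure.comap (graphMap e f) (Measure.hausdorffMeasure 1 : Measure Plane) A = 0 := by
    intro A hA
    rw [hemb.comap_apply]
    refine le_antisymm ((hausdorffMeasure_graphMap_image_le e f K.coe_nonneg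
      (fun x _ y _ => hlip x y)).trans ?_) zero_le
    simp [hA]
  have hpieces : ∀ δ : ℝ, 0 < δ → ∃ (T : ℕ → Set ℝ) (q : ℕ → ℝ),
      Pairwise (Function.onFun Disjoint T) ∧ (∀ n, MeasurableSet (T n)) ∧
      volume (⋃ n, T n)ᶜ = 0 ∧
      (∀ n, ∀ x ∈ T n, ∀ y ∈ T n, |f x - f y - q n * (x - y)| ≤ δ * |x - y|) ∧
      ∀ n, ∀ᵐ x ∂volume.restrict (T n), |deriv f x - q n| ≤ δ := by
    intro δ hδ
    obtain ⟨t, A, hd, hm, hc, ha, -⟩ :=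
      exists_partition_approximatesLinearOn_of_hasFDerivWithinAt f G (fderiv ℝ f)
        (fun x hx => (DifferentiableAt.hasFDerivAt hx).hasFDerivWithinAt)
        (fun _ => Real.toNNReal δ) (fun _ => (Real.toNNReal_pos.2 hδ).ne')
    refine ⟨fun n => G ∩ t n, fun n => A n 1, fun i j hij =>
      (hd hij).mono Set.inter_subset_right Set.inter_subset_right,
      fun n => hGm.inter (hm n), ?_, ?_, ?_⟩
    · rwa [← Set.inter_iUnion, Set.inter_eq_left.2 hc]
    · intro n x hx y hy
      have := ha n x hx y hy
      rw [Real.coe_toNNReal _ hδ.le, Real.norm_eq_abs, Real.norm_eq_abs] at this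
      have h1 : A n (x - y) = A n 1 * (x - y) := by
        conv_lhs => rw [show x - y = (x - y) • (1 : ℝ) by simp, map_smul, smul_eq_mul, mul_comm]
      rwa [h1] at this
    · intro n
      filter_upwards [(ha n).norm_fderiv_sub_le volume (hGm.inter (hm n)) (fderiv ℝ f)
        fun x hx => (DifferentiableAt.hasFDerivAt hx.1).hasFDerivWithinAt] with x hx
      have h2 : ‖fderiv ℝ f x - A n‖ ≤ δ := by
        have := NNReal.coe_le_coe.2 hx
        rwa [Real.coe_toNNReal _ hδ.le] at this
      have h3 := (fderiv ℝ f x - A n).le_opNorm 1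
      rw [norm_one, mul_one] at h3
      simpa [fderiv_apply_one_eq_deriv] using h3.trans h2
  have hmeas : Measurable fun x => ENNReal.ofReal (√(1 + deriv f x ^ 2)) := by
    have := measurable_deriv f
    fun_prop
  refine measure_eq_of_forall_le_add (fun δ hδ hδ1 => ?_) (fun δ hδ hδ1 => ?_)
  -- One half of `δ` pays for the distortion of lengths, the other for replacing `q` by `f'`.
  · obtain ⟨T, q, hd, hm, h0, hT, hq⟩ := hpieces (δ / 2) (by positivity)
    refine measure_le_of_disjoint_cover hd hm (hac _ h0) fun n A hA hAT => ?_
    rw [hemb.comap_apply]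
    refine (hausdorffMeasure_graphMap_image_le e f (by positivity)
      fun x hx y hy => hT n x (hAT hx) y (hAT hy)).trans ?_
    rw [Measure.add_apply, Measure.smul_apply, withDensity_apply _ hA, smul_eq_mul,
      ← setLIntegral_const, ← setLIntegral_const, ← lintegral_add_left hmeas]
    refine lintegral_mono_ae ?_
    filter_upwards [ae_mono (Measure.restrict_mono hAT le_rfl) (hq n)] with x hx
    rw [← ENNReal.ofReal_add (by positivity) hδ.le]
    refine ENNReal.ofReal_le_ofReal ?_
    have := sqrt_one_add_sq_le (q n) (deriv f x)
    rw [abs_sub_comm] at this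
    linarith
  · obtain ⟨T, q, hd, hm, h0, hT, hq⟩ := hpieces (δ / 2) (by positivity)
    refine measure_le_of_disjoint_cover hd hm (withDensity_absolutelyContinuous _ _ h0)
      fun n A hA hAT => ?_
    rw [Measure.add_apply, hemb.comap_apply, withDensity_apply _ hA, Measure.smul_apply,
      smul_eq_mul]
    have h1 : 1 ≤ √(1 + q n ^ 2) := Real.one_le_sqrt.2 (by nlinarith [sq_nonneg (q n)])
    calc ∫⁻ x in A, ENNReal.ofReal (√(1 + deriv f x ^ 2))
        ≤ ∫⁻ x in A, ENNReal.ofReal (√(1 + q n ^ 2) - δ / 2 + δ) := by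
          refine lintegral_mono_ae ?_
          filter_upwards [ae_mono (Measure.restrict_mono hAT le_rfl) (hq n)] with x hx
          refine ENNReal.ofReal_le_ofReal ?_
          have := sqrt_one_add_sq_le (deriv f x) (q n)
          linarith
      _ = ENNReal.ofReal (√(1 + q n ^ 2) - δ / 2) * volume A + ENNReal.ofReal δ * volume A := by
          rw [setLIntegral_const, ENNReal.ofReal_add (by linarith) hδ.le, add_mul]
      _ ≤ _ := by
          gcongr
          exact le_hausdorffMeasure_graphMap_image e f (by linarith)
            fun x hx y hy => hT n x (hAT hx) y (hAT hy)

/-- The arc length of the graph of a Lipschitz function. -/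
lemma hausdorffMeasure_restrict_range_graphMap (hf : LipschitzWith K f) :
    (Measure.hausdorffMeasure 1 : Measure Plane).restrict (Set.range (graphMap e f)) =
      Measure.map (graphMap e f)
        (volume.withDensity fun x => ENNReal.ofReal (√(1 + deriv f x ^ 2))) := by
  rw [← comap_graphMap_hausdorffMeasure e hf,
    (measurableEmbedding_graphMap e hf.continuous).map_comap]

end AreaFormula

/-! ### The divergence theorem below a Lipschitz graph -/

section Subgraph

variable (e : Plane ≃ₗᵢ[ℝ] Plane) {f : ℝ → ℝ} {K : NNReal}

lemma graphMap_add (f : ℝ → ℝ) (x y : ℝ) :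
    graphMap e (fun s => y + f s) x = graphMap e f x + y • e.symm (EuclideanSpace.single 1 1) := by
  rw [graphMap, graphMap, ← map_smul, ← map_add]
  congr 1
  ext i
  fin_cases i <;> simp [add_comm]

lemma hasDerivAt_graphMap {x f' : ℝ} (h : HasDerivAt f f' x) :
    HasDerivAt (graphMap e f) (e.symm !₂[1, f']) x := by
  have h1 : HasDerivAt (fun x => (!₂[x, f x] : Plane)) !₂[1, f'] x := by
    have : HasDerivAt (fun x => (![x, f x] : Fin 2 → ℝ)) ![1, f'] x := by
      rw [hasDerivAt_pi]
      intro i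
      fin_cases i
      · exact hasDerivAt_id x
      · exact h
    exact (PiLp.continuousLinearEquiv 2 ℝ (fun _ : Fin 2 => ℝ)).symm.hasFDerivAt.comp_hasDerivAt x
      this
  exact e.symm.toContinuousLinearEquiv.hasFDerivAt.comp_hasDerivAt x h1

/-- Coordinates of the plane which flatten the graph of `f`. -/
noncomputable def shearHomeomorph (hf : Continuous f) : ℝ × ℝ ≃ₜ Plane where
  toFun z := graphMap e (fun s => z.2 + f s) z.1
  invFun p := ((e p) 0, (e p) 1 - f ((e p) 0))
  left_inv z := by simp [graphMap_apply_zero, graphMap_apply_one]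
  right_inv p := by
    refine (LinearIsometryEquiv.symm_apply_eq e).2 ?_
    ext i
    fin_cases i <;> simp
  continuous_toFun := by unfold graphMap; fun_prop
  continuous_invFun := by fun_prop

lemma shearHomeomorph_apply (hf : Continuous f) (z : ℝ × ℝ) :
    shearHomeomorph e hf z = graphMap e (fun s => z.2 + f s) z.1 := rfl

lemma measurePreserving_shearHomeomorph (hf : Continuous f) :
    MeasurePreserving (shearHomeomorph e hf) volume volume := by
  have h1 : MeasurePreserving (fun z : ℝ × ℝ => (z.1, z.2 + f z.1)) volume volume := by
    refine (MeasurePreserving.id (volume : Measure ℝ)).skew_product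
      (g := fun x y => y + f x) ?_ (ae_of_all _ fun x => ?_)
    · exact (measurable_snd.add (hf.measurable.comp measurable_fst))
    · exact (measurePreserving_add_right volume (f x)).map_eq
  have h2 := (e.symm.measurePreserving.comp (PiLp.volume_preserving_toLp (Fin 2))).comp
    (((volume_preserving_finTwoArrow ℝ).symm).comp h1)
  have h3 : ⇑(shearHomeomorph e hf) = (e.symm ∘ WithLp.toLp 2) ∘
      (MeasurableEquiv.finTwoArrow (α := ℝ)).symm ∘ fun z => (z.1, z.2 + f z.1) := by
    ext z : 1
    rw [shearHomeomorph_apply, graphMap]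
    simp only [Function.comp_apply]
    congr 1
  rw [h3]
  exact h2

lemma shearHomeomorph_preimage_subgraph (hf : Continuous f) :
    shearHomeomorph e hf ⁻¹' {p | (e p) 1 < f ((e p) 0)} = Set.univ ×ˢ Set.Iio 0 := by
  ext z
  simp [shearHomeomorph_apply, graphMap_apply_zero, graphMap_apply_one]

/-- Integration by parts against the constant `1`; the direction is `-1` because the formula
reverses it on the other factor. -/
lemma integral_deriv_eq_zero_of_lipschitz {g : ℝ → ℝ} {C : NNReal} (hg : LipschitzWith C g)
    (hc : HasCompactSupport g) : ∫ x, deriv g x = 0 := by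
  have := LipschitzWith.integral_lineDeriv_mul_eq (μ := volume) (LipschitzWith.const (1 : ℝ)) hg hc
    (-1 : ℝ)
  simp only [lineDeriv, deriv_const, zero_mul, integral_zero, neg_neg, mul_one] at this
  rw [this]
  congr 1
  ext x
  simp only [smul_eq_mul, mul_one]
  rw [deriv_comp_const_add, add_zero]

lemma hasDerivAt_comp_graphMap {φ : Plane → ℝ} (hφ : ContDiff ℝ 1 φ) (y : ℝ) {x : ℝ}
    (h : DifferentiableAt ℝ f x) :
    HasDerivAt (fun s => φ (graphMap e (fun s => y + f s) s))
      (fderiv ℝ φ (graphMap e (fun s => y + f s) x) (e.symm (EuclideanSpace.single 0 1)) +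
        deriv f x *
          fderiv ℝ φ (graphMap e (fun s => y + f s) x) (e.symm (EuclideanSpace.single 1 1))) x := by
  have h1 := ((hφ.differentiable one_ne_zero) (graphMap e (fun s => y + f s) x)).hasFDerivAt
  have h2 := h1.comp_hasDerivAt x (hasDerivAt_graphMap e (h.hasDerivAt.const_add y))
  refine h2.congr_deriv (Eq.symm ?_)
  rw [← smul_eq_mul, ← map_smul, ← map_add, ← map_smul, ← map_add]
  congr 2
  ext i
  fin_cases i <;> simp

/-- The divergence theorem on the region below a Lipschitz graph. -/
lemma integral_subgraph_fderiv (hf : LipschitzWith K f) {φ : Plane → ℝ} (hφ : ContDiff ℝ 1 φ)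
    (hc : HasCompactSupport φ) (a : Plane) :
    ∫ p in {p | (e p) 1 < f ((e p) 0)}, fderiv ℝ φ p a =
      ∫ x, φ (graphMap e f x) * ((e a) 1 - (e a) 0 * deriv f x) := by
  set T := shearHomeomorph e hf.continuous with hT
  set e0 : Plane := e.symm (EuclideanSpace.single 0 1) with he0
  set e1 : Plane := e.symm (EuclideanSpace.single 1 1) with he1
  have ha : a = (e a) 0 • e0 + (e a) 1 • e1 := by
    rw [he0, he1, ← map_smul, ← map_smul, ← map_add, LinearIsometryEquiv.eq_symm_apply]
    ext i
    fin_cases i <;> simp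
  have hderiv : ∀ b : Plane, Integrable (fun z => fderiv ℝ φ (T z) b) := fun b => by
    refine Continuous.integrable_of_hasCompactSupport ?_ ?_
    · exact ((hφ.continuous_fderiv one_ne_zero).clm_apply continuous_const).comp T.continuous
    · exact (hc.fderiv_apply ℝ b).comp_homeomorph T
  have hderiv' : ∀ b : Plane, Integrable (fun z => fderiv ℝ φ (T z) b)
      (volume.prod (volume.restrict (Set.Iio 0))) := fun b => by
    have := (hderiv b).integrableOn (s := Set.univ ×ˢ Set.Iio 0)
    rwa [IntegrableOn, Measure.volume_eq_prod, ← Measure.prod_restrict,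
      Measure.restrict_univ] at this
  have hbd : ∀ᵐ z ∂((volume : Measure ℝ).prod (volume.restrict (Set.Iio (0 : ℝ)))),
      ‖deriv f z.1‖ ≤ K := ae_of_all _ fun z => norm_deriv_le_of_lipschitz hf
  have hmul : ∀ b : Plane, Integrable (fun z => deriv f z.1 * fderiv ℝ φ (T z) b)
      (volume.prod (volume.restrict (Set.Iio 0))) := fun b =>
    (hderiv' b).bdd_mul ((measurable_deriv f).comp measurable_fst).aestronglyMeasurable hbd
  -- In the flattened coordinates the region is `y < 0`, so the vertical derivative integrates to
  -- the boundary value.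
  have hvert : ∀ x, ∫ y in Set.Iio 0, fderiv ℝ φ (T (x, y)) e1 = φ (graphMap e f x) := by
    intro x
    have hline : ∀ y, T (x, y) = graphMap e f x + y • e1 := fun y => graphMap_add e f x y
    have hcd : ContDiff ℝ 1 fun y => φ (T (x, y)) := by
      simp only [hline]
      fun_prop
    have hcs : HasCompactSupport fun y => φ (T (x, y)) := by
      have hce : IsClosedEmbedding fun y : ℝ => T (x, y) :=
        T.isClosedEmbedding.comp (Function.LeftInverse.isClosedEmbedding (f := Prod.snd)
          (fun _ => rfl) continuous_snd (by fun_prop))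
      exact hc.comp_isClosedEmbedding hce
    have := hcs.integral_Iic_deriv_eq hcd 0
    rw [← integral_Iic_eq_integral_Iio]
    convert this using 3 with y
    · have h1 := ((hφ.differentiable one_ne_zero) (T (x, y))).hasFDerivAt
      have h2 : HasDerivAt (fun y : ℝ => T (x, y)) e1 y := by
        simp only [hline]
        simpa using ((hasDerivAt_id y).smul_const e1).const_add (graphMap e f x)
      exact (h1.comp_hasDerivAt y h2).deriv.symm
    · simp [hline]
  -- The integrand is the derivative of `φ` along a translate of the graph, a compactly supported
  -- Lipschitz function of `x`. This trades the `e0`-derivative for `-f'` times the `e1`-derivative,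
  -- which `hvert` evaluates.
  have hhor : ∀ y, ∫ x, (fderiv ℝ φ (T (x, y)) e0 + deriv f x * fderiv ℝ φ (T (x, y)) e1) = 0 := by
    intro y
    obtain ⟨C, hC⟩ := hφ.lipschitzWith_of_hasCompactSupport hc one_ne_zero
    have hg : LipschitzWith (1 + K) (graphMap e (fun s => y + f s)) := by
      refine LipschitzWith.of_dist_le_mul fun s t => ?_
      have h3 : |f s - f t| ≤ K * |s - t| := hf.dist_le_mul s t
      rw [dist_graphMap, Real.sqrt_le_left (by positivity), Real.dist_eq]
      push_cast
      have h4 : (f s - f t) ^ 2 ≤ (K * |s - t|) ^ 2 := sq_le_sq.2 (h3.trans (le_abs_self _))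
      have h5 : 0 ≤ (K : ℝ) * |s - t| ^ 2 := by positivity
      rw [← sq_abs (s - t)]
      nlinarith
    have hcs : HasCompactSupport fun s => φ (graphMap e (fun s => y + f s) s) := by
      have hce : IsClosedEmbedding fun s : ℝ => T (s, y) :=
        T.isClosedEmbedding.comp (Function.LeftInverse.isClosedEmbedding (f := Prod.fst)
          (fun _ => rfl) continuous_fst (by fun_prop))
      exact hc.comp_isClosedEmbedding hce
    rw [← integral_deriv_eq_zero_of_lipschitz (hC.comp hg) hcs]
    refine integral_congr_ae ?_
    filter_upwards [hf.ae_differentiableAt_real] with x hx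
    exact (hasDerivAt_comp_graphMap e hφ y hx).deriv.symm
  have hE1 : ∫ x, ∫ y in Set.Iio 0, fderiv ℝ φ (T (x, y)) e1 = ∫ x, φ (graphMap e f x) :=
    integral_congr_ae (ae_of_all _ hvert)
  have hE2 : ∫ x, ∫ y in Set.Iio 0, deriv f x * fderiv ℝ φ (T (x, y)) e1 =
      ∫ x, deriv f x * φ (graphMap e f x) := by
    refine integral_congr_ae (ae_of_all _ fun x => ?_)
    simp only [integral_const_mul, hvert]
  have hE0 : ∫ x, ∫ y in Set.Iio 0, fderiv ℝ φ (T (x, y)) e0 =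
      -∫ x, deriv f x * φ (graphMap e f x) := by
    have h := integral_integral_swap (f := fun x y => fderiv ℝ φ (T (x, y)) e0 +
      deriv f x * fderiv ℝ φ (T (x, y)) e1) ((hderiv' e0).add (hmul e1))
    simp only [hhor, integral_zero] at h
    have h' := integral_prod _ ((hderiv' e0).add (hmul e1))
    simp only [Pi.add_apply] at h'
    rw [h, integral_add (hderiv' e0) (hmul e1), integral_prod _ (hderiv' e0),
      integral_prod _ (hmul e1), hE2] at h'
    linarith
  have hint : Integrable fun x => φ (graphMap e f x) := by
    refine Continuous.integrable_of_hasCompactSupport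
      (hφ.continuous.comp (continuous_graphMap e hf.continuous)) ?_
    have hce : IsClosedEmbedding fun s : ℝ => T (s, 0) :=
      T.isClosedEmbedding.comp (Function.LeftInverse.isClosedEmbedding (f := Prod.fst)
        (fun _ => rfl) continuous_fst (by fun_prop))
    have := hc.comp_isClosedEmbedding hce
    simpa [Function.comp_def, hT, shearHomeomorph_apply] using this
  have hint' : Integrable fun x => deriv f x * φ (graphMap e f x) :=
    hint.bdd_mul (measurable_deriv f).aestronglyMeasurable
      (ae_of_all _ fun z => norm_deriv_le_of_lipschitz hf)
  rw [← (measurePreserving_shearHomeomorph e hf.continuous).setIntegral_preimage_emb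
    T.measurableEmbedding, shearHomeomorph_preimage_subgraph, Measure.volume_eq_prod,
    ← Measure.prod_restrict, Measure.restrict_univ]
  have hsplit : ∀ z, fderiv ℝ φ (T z) a =
      (e a) 0 * fderiv ℝ φ (T z) e0 + (e a) 1 * fderiv ℝ φ (T z) e1 := fun z => by
    conv_lhs => rw [ha]
    simp
  calc _ = ∫ z, ((e a) 0 * fderiv ℝ φ (T z) e0 + (e a) 1 * fderiv ℝ φ (T z) e1)
        ∂(volume.prod (volume.restrict (Set.Iio 0))) := by simp only [← hT, hsplit]
    _ = (e a) 0 * (-∫ x, deriv f x * φ (graphMap e f x)) +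
        (e a) 1 * ∫ x, φ (graphMap e f x) := by
      rw [integral_add ((hderiv' e0).const_mul _) ((hderiv' e1).const_mul _), integral_const_mul,
        integral_const_mul, integral_prod _ (hderiv' e0), integral_prod _ (hderiv' e1), hE0, hE1]
    _ = _ := by
      rw [mul_neg, ← integral_const_mul, ← integral_const_mul, neg_add_eq_sub,
        ← integral_sub (hint.const_mul _) (hint'.const_mul _)]
      congr 1
      ext x
      ring

end Subgraph

/-! ### Charts and outward normals -/

/-- The divergence theorem and the interior cone condition for `Ω`, localized to the open set `V`;
`ν` is a direction which points out of `Ω` along `∂Ω ∩ V`. -/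
structure IsChart (Ω V : Set Plane) (ν : Plane) : Prop where
  isOpen : IsOpen V
  bounded : Bornology.IsBounded V
  gauss : ∀ φ : Plane → ℝ, ContDiff ℝ 1 φ → HasCompactSupport φ → tsupport φ ⊆ V → ∀ a : Plane,
    ∫ x in Ω, fderiv ℝ φ x a = ∫ x, φ x * inner ℝ a (outerNormal Ω x) ∂(bdryMeasure Ω)
  cone : ∃ δ : ℝ, 0 < δ ∧ ∀ y ∈ Ω, y ∈ V → ∀ z ∈ Metric.ball ν δ, ∀ s : ℝ, 0 < s →
    y - s • z ∈ V → y - s • z ∈ Ω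
  transversal : ∃ c : ℝ, 0 < c ∧
    ∀ᵐ x ∂((bdryMeasure Ω).restrict V), c ≤ inner ℝ ν (outerNormal Ω x)
  finite : bdryMeasure Ω V < ∞
  meas : AEStronglyMeasurable (outerNormal Ω) ((bdryMeasure Ω).restrict V)

/-- If `n ≠ n'`, then `d = n' - n` points strictly inward for `n` and strictly outward for `n'`, so
`x + s d` with small `s > 0` would be both in `Ω` and outside it. -/
lemma IsOuterNormal.unique {Ω : Set Plane} {x n n' : Plane} (h : IsOuterNormal Ω x n)
    (h' : IsOuterNormal Ω x n') : n = n' := by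
  by_contra hne
  set d : Plane := n' - n with hd
  have hd0 : d ≠ 0 := sub_ne_zero.2 (Ne.symm hne)
  have hdp : 0 < ‖d‖ := norm_pos_iff.2 hd0
  have hlt : inner ℝ n' n < (1 : ℝ) :=
    (inner_lt_one_iff_real_of_norm_eq_one h'.1 h.1).2 (Ne.symm hne)
  have h1 : inner ℝ d n = inner ℝ n' n - 1 := by
    rw [hd, inner_sub_left, real_inner_self_eq_norm_sq, h.1]; norm_num
  have h2 : inner ℝ d n' = 1 - inner ℝ n' n := by
    rw [hd, inner_sub_left, real_inner_self_eq_norm_sq, h'.1, real_inner_comm]; norm_num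
  set c : ℝ := 1 - inner ℝ n' n with hc
  have hcp : 0 < c := by linarith
  set δ : ℝ := c / (2 * ‖d‖) with hδ
  have hδp : 0 < δ := by positivity
  have hδd : δ * ‖d‖ < c := by rw [hδ]; field_simp; linarith
  have ht : Tendsto (fun s : ℝ => x + s • d) (𝓝[>] 0) (𝓝 x) := by
    have : Tendsto (fun s : ℝ => x + s • d) (𝓝 0) (𝓝 (x + (0 : ℝ) • d)) :=
      (continuous_const.add (continuous_id.smul continuous_const)).tendsto 0
    rw [zero_smul, add_zero] at this
    exact this.mono_left nhdsWithin_le_nhds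
  obtain ⟨s, ⟨hs1, hs2⟩, hs⟩ := (((ht.eventually (h.2 δ hδp)).and
    (ht.eventually (h'.2 δ hδp))).and self_mem_nhdsWithin).exists
  replace hs : 0 < s := hs
  rw [add_sub_cancel_left, inner_smul_left, norm_smul, Real.norm_of_nonneg hs.le] at hs1 hs2
  simp only [conj_trivial] at hs1 hs2
  refine hs2.2 ?_ (hs1.1 ?_)
  · rw [h2]; nlinarith
  · rw [h1]; nlinarith

lemma IsOuterNormal.outerNormal_eq {Ω : Set Plane} {x n : Plane} (h : IsOuterNormal Ω x n) :
    outerNormal Ω x = n := by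
  have hex : ∃ n, IsOuterNormal Ω x n := ⟨n, h⟩
  rw [outerNormal, dif_pos hex]
  exact hex.choose_spec.unique h

lemma norm_outerNormal_le (Ω : Set Plane) (x : Plane) : ‖outerNormal Ω x‖ ≤ 1 := by
  rw [outerNormal]
  split_ifs with h
  · exact h.choose_spec.1.le
  · simp

/-- The upper unit normal to a line of slope `m`, in the Cartesian coordinates `e`. -/
noncomputable def slopeNormal (e : Plane ≃ₗᵢ[ℝ] Plane) (m : ℝ) : Plane :=
  e.symm !₂[-m / √(1 + m ^ 2), 1 / √(1 + m ^ 2)]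

section Normal

variable (e : Plane ≃ₗᵢ[ℝ] Plane)

lemma inner_slopeNormal (a : Plane) (m : ℝ) :
    inner ℝ a (slopeNormal e m) = ((e a) 1 - m * (e a) 0) / √(1 + m ^ 2) := by
  rw [slopeNormal, ← LinearIsometryEquiv.inner_map_map e, LinearIsometryEquiv.apply_symm_apply]
  simp [PiLp.inner_apply, Fin.sum_univ_two]
  ring

lemma norm_slopeNormal (m : ℝ) : ‖slopeNormal e m‖ = 1 := by
  have h : 0 < 1 + m ^ 2 := by positivity
  have hs : √(1 + m ^ 2) ≠ 0 := (Real.sqrt_pos.2 h).ne'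
  rw [slopeNormal, LinearIsometryEquiv.norm_map, EuclideanSpace.norm_eq, Real.sqrt_eq_one]
  simp only [Fin.sum_univ_two, Matrix.cons_val_zero, Matrix.cons_val_one,
    Real.norm_eq_abs, sq_abs, div_pow, Real.sq_sqrt h.le]
  field_simp
  ring

lemma continuous_slopeNormal : Continuous (slopeNormal e) := by
  have : ∀ m : ℝ, √(1 + m ^ 2) ≠ 0 := fun m => (Real.sqrt_pos.2 (by positivity)).ne'
  unfold slopeNormal
  fun_prop (disch := exact this _)

/-- Near `x` the graph stays within `δ |u - x|` of its tangent line, so a point whose signed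
distance from that line exceeds `δ ‖y - p‖` lies on the corresponding side of the graph. -/
lemma isOuterNormal_graphMap {Ω : Set Plane} {V : Set Plane} (hV : IsOpen V) {f : ℝ → ℝ}
    (hΩ : ∀ y ∈ V, (y ∈ Ω ↔ (e y) 1 < f ((e y) 0))) {x : ℝ} (hx : graphMap e f x ∈ V)
    (hf : DifferentiableAt ℝ f x) :
    IsOuterNormal Ω (graphMap e f x) (slopeNormal e (deriv f x)) := by
  refine ⟨norm_slopeNormal e _, fun δ hδ => ?_⟩
  set m := deriv f x with hm
  set p := graphMap e f x with hp
  have hp0 : (e p) 0 = x := graphMap_apply_zero e f x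
  have hp1 : (e p) 1 = f x := graphMap_apply_one e f x
  have h1 : ∀ᶠ u in 𝓝 x, |f u - f x - m * (u - x)| ≤ δ * |u - x| := by
    have := (hasDerivAt_iff_isLittleO.1 hf.hasDerivAt).def hδ
    filter_upwards [this] with u hu
    rw [Real.norm_eq_abs, Real.norm_eq_abs, smul_eq_mul, mul_comm] at hu
    exact hu
  have ht : Tendsto (fun y : Plane => (e y) 0) (𝓝 p) (𝓝 x) := by
    have : Continuous fun y : Plane => (e y) 0 := by fun_prop
    simpa [hp0] using this.tendsto p
  filter_upwards [ht.eventually h1, hV.mem_nhds hx] with y hy hyV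
  rw [inner_slopeNormal, hΩ y hyV, map_sub]
  simp only [PiLp.sub_apply, hp0, hp1]
  set s := √(1 + m ^ 2) with hs
  have hs1 : 1 ≤ s := Real.one_le_sqrt.2 (by nlinarith [sq_nonneg m])
  have hs0 : 0 < s := by linarith
  have hle : |(e y) 0 - x| ≤ ‖y - p‖ := by
    have := PiLp.norm_apply_le (e (y - p)) 0
    rwa [LinearIsometryEquiv.norm_map, map_sub, PiLp.sub_apply, hp0, Real.norm_eq_abs] at this
  have hδle : δ * |(e y) 0 - x| ≤ δ * ‖y - p‖ := by gcongr
  have hsle : δ * ‖y - p‖ ≤ δ * ‖y - p‖ * s := le_mul_of_one_le_right (by positivity) hs1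
  rw [abs_le] at hy
  constructor
  · intro h
    rw [div_lt_iff₀ hs0] at h
    linarith
  · intro h
    rw [lt_div_iff₀ hs0] at h
    rw [not_lt]
    linarith

end Normal

lemma integral_fderiv_eq_zero {φ : Plane → ℝ} (hφ : ContDiff ℝ 1 φ) (hc : HasCompactSupport φ)
    (a : Plane) : ∫ x, fderiv ℝ φ x a = 0 := by
  obtain ⟨C, hC⟩ := hφ.lipschitzWith_of_hasCompactSupport hc one_ne_zero
  have := LipschitzWith.integral_lineDeriv_mul_eq (μ := volume)
    (LipschitzWith.const (α := Plane) (1 : ℝ)) hC hc (-a)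
  simp only [lineDeriv, deriv_const, zero_mul, integral_zero, neg_neg, mul_one] at this
  rw [this]
  congr 1
  ext x
  exact (((hφ.differentiable one_ne_zero) x).lineDeriv_eq_fderiv (v := a)).symm

lemma support_fderiv_apply_subset (φ : Plane → ℝ) (a : Plane) :
    ∀ x, x ∉ tsupport φ → fderiv ℝ φ x a = 0 := fun x hx => by
  have : fderiv ℝ φ x = 0 := by
    by_contra h
    exact hx (support_fderiv_subset ℝ h)
  simp [this]

/-- The interior chart. An open set has no boundary points in it, so the boundary conditions are
void and `ν` is arbitrary. -/
lemma isChart_self {Ω : Set Plane} (hΩ : IsOpen Ω) (hb : Bornology.IsBounded Ω) (ν : Plane) :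
    IsChart Ω Ω ν := by
  have h0 : (bdryMeasure Ω) Ω = 0 := by
    rw [bdryMeasure, Measure.restrict_apply hΩ.measurableSet, hΩ.inter_frontier_eq, measure_empty]
  have h0' : (bdryMeasure Ω).restrict Ω = 0 := Measure.restrict_eq_zero.2 h0
  refine ⟨hΩ, hb, fun φ hφ hc hs a => ?_, ⟨1, one_pos, fun y _ _ z _ s _ h => h⟩,
    ⟨1, one_pos, ?_⟩,
    by simp [h0], by simp [h0']⟩
  · rw [setIntegral_eq_integral_of_forall_compl_eq_zero, integral_fderiv_eq_zero hφ hc]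
    · refine (integral_eq_zero_of_ae ?_).symm
      have : ∀ᵐ x ∂(bdryMeasure Ω), x ∉ Ω := measure_eq_zero_iff_ae_notMem.1 h0
      filter_upwards [this] with x hx
      rw [image_eq_zero_of_notMem_tsupport fun h => hx (hs h)]
      simp
    · exact fun x hx => support_fderiv_apply_subset φ a x fun h => hx (hs h)
  · simp [h0']

section BoundaryChart

variable {Ω V : Set Plane} (e : Plane ≃ₗᵢ[ℝ] Plane) {f : ℝ → ℝ} {K : NNReal}

lemma frontier_subgraph (hf : Continuous f) :
    frontier {p : Plane | (e p) 1 < f ((e p) 0)} = Set.range (graphMap e f) := by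
  have h := (shearHomeomorph e hf).preimage_frontier {p : Plane | (e p) 1 < f ((e p) 0)}
  rw [shearHomeomorph_preimage_subgraph, frontier_univ_prod_eq, frontier_Iio] at h
  refine (shearHomeomorph e hf).surjective.preimage_injective (h.trans ?_)
  ext z
  rw [Set.mem_preimage, mem_range_graphMap, shearHomeomorph_apply, graphMap_apply_one,
    graphMap_apply_zero]
  simp

/-- Inside an open set `V`, the frontier depends only on `Ω ∩ V`. -/
lemma bdryMeasure_restrict_eq (hV : IsOpen V) (hf : LipschitzWith K f)
    (hΩ : ∀ y ∈ V, (y ∈ Ω ↔ (e y) 1 < f ((e y) 0))) :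
    (bdryMeasure Ω).restrict V = (Measure.map (graphMap e f)
        (volume.withDensity fun x => ENNReal.ofReal (√(1 + deriv f x ^ 2)))).restrict V := by
  have h1 : Ω ∩ V = {p : Plane | (e p) 1 < f ((e p) 0)} ∩ V := by
    ext y
    simp only [Set.mem_inter_iff, Set.mem_ofPred_eq]
    exact ⟨fun h => ⟨(hΩ y h.2).1 h.1, h.2⟩, fun h => ⟨(hΩ y h.2).2 h.1, h.2⟩⟩
  have h2 : frontier Ω ∩ V = Set.range (graphMap e f) ∩ V := by
    rw [← frontier_inter_open_inter hV, h1, frontier_inter_open_inter hV,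
      frontier_subgraph e hf.continuous]
  rw [bdryMeasure, ← hausdorffMeasure_restrict_range_graphMap e hf,
    Measure.restrict_restrict hV.measurableSet, Measure.restrict_restrict hV.measurableSet,
    Set.inter_comm, h2, Set.inter_comm]

lemma ae_bdryMeasure_restrict (hV : IsOpen V) (hf : LipschitzWith K f)
    (hΩ : ∀ y ∈ V, (y ∈ Ω ↔ (e y) 1 < f ((e y) 0))) :
    ∀ᵐ y ∂((bdryMeasure Ω).restrict V),
      outerNormal Ω y = slopeNormal e (deriv f ((e y) 0)) := by
  rw [bdryMeasure_restrict_eq e hV hf hΩ, ae_restrict_iff' hV.measurableSet,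
    (measurableEmbedding_graphMap e hf.continuous).ae_map_iff]
  refine (withDensity_absolutelyContinuous _ _).ae_le ?_
  filter_upwards [hf.ae_differentiableAt_real] with x hx hxV
  rw [graphMap_apply_zero]
  exact (isOuterNormal_graphMap e hV hΩ hxV hx).outerNormal_eq

/-- The boundary chart. In the divergence theorem, the length element `√(1 + f'²)` cancels the
normalizing denominator of the unit normal. -/
lemma isChart_subgraph (hV : IsOpen V) (hVb : Bornology.IsBounded V) (hf : LipschitzWith K f)
    (hΩo : IsOpen Ω) (hΩ : ∀ y ∈ V, (y ∈ Ω ↔ (e y) 1 < f ((e y) 0))) :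
    IsChart Ω V (e.symm (EuclideanSpace.single 1 1)) := by
  have hemb := measurableEmbedding_graphMap e hf.continuous
  have hn := ae_bdryMeasure_restrict e hV hf hΩ
  have hdm : Measurable fun x => ENNReal.ofReal (√(1 + deriv f x ^ 2)) := by
    have := measurable_deriv f
    fun_prop
  -- The first constant is the opening of a cone steeper than the graph. The second is the least
  -- possible vertical component of the normal when `|f'| ≤ K`.
  refine ⟨hV, hVb, fun φ hφ hc hs a => ?_, ⟨1 / (1 + K), by positivity, ?_⟩,
    ⟨1 / √(1 + (K : ℝ) ^ 2), by positivity, ?_⟩, ?_, ?_⟩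
  · have hz : ∀ x, x ∉ V → fderiv ℝ φ x a = 0 := fun x hx =>
      support_fderiv_apply_subset φ a x fun h => hx (hs h)
    have hz' : ∀ x, x ∉ V → φ x = 0 := fun x hx =>
      image_eq_zero_of_notMem_tsupport fun h => hx (hs h)
    have hI1 : ∫ x in Ω, fderiv ℝ φ x a =
        ∫ x in {p : Plane | (e p) 1 < f ((e p) 0)}, fderiv ℝ φ x a := by
      have hSm : MeasurableSet {p : Plane | (e p) 1 < f ((e p) 0)} := by
        refine (isOpen_lt ?_ ?_).measurableSet
        · fun_prop
        · exact hf.continuous.comp (by fun_prop)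
      rw [← integral_indicator hΩo.measurableSet, ← integral_indicator hSm]
      congr 1
      ext x
      by_cases hx : x ∈ V
      · by_cases hxΩ : x ∈ Ω
        · rw [Set.indicator_of_mem hxΩ, Set.indicator_of_mem]
          exact (hΩ x hx).1 hxΩ
        · rw [Set.indicator_of_notMem hxΩ, Set.indicator_of_notMem]
          exact fun h => hxΩ ((hΩ x hx).2 h)
      · simp [Set.indicator, hz x hx]
    have hI2 : ∫ x, φ x * inner ℝ a (outerNormal Ω x) ∂(bdryMeasure Ω) =
        ∫ x in V, φ x * inner ℝ a (slopeNormal e (deriv f ((e x) 0))) ∂(bdryMeasure Ω) := by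
      rw [← setIntegral_eq_integral_of_forall_compl_eq_zero (s := V)
        fun x hx => by rw [hz' x hx, zero_mul]]
      refine integral_congr_ae ?_
      filter_upwards [hn] with x hx
      rw [hx]
    rw [hI1, hI2, integral_subgraph_fderiv e hf hφ hc, bdryMeasure_restrict_eq e hV hf hΩ,
      setIntegral_eq_integral_of_forall_compl_eq_zero fun x hx => by rw [hz' x hx, zero_mul],
      hemb.integral_map, integral_withDensity_eq_integral_toReal_smul hdm
        (ae_of_all _ fun _ => ENNReal.ofReal_lt_top)]
    congr 1
    ext x
    have hs0 : 0 < √(1 + deriv f x ^ 2) := Real.sqrt_pos.2 (by positivity)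
    rw [graphMap_apply_zero, inner_slopeNormal, ENNReal.toReal_ofReal hs0.le, smul_eq_mul]
    field_simp
  · intro y hy hyV z hz s hs hyz
    rw [hΩ _ hyz]
    have h1 := (hΩ y hyV).1 hy
    have hz' : ‖e z - EuclideanSpace.single 1 1‖ < 1 / (1 + K) := by
      have := mem_ball_iff_norm.1 hz
      rwa [← LinearIsometryEquiv.norm_map e, map_sub, LinearIsometryEquiv.apply_symm_apply] at this
    have hz0 : |(e z) 0| < 1 / (1 + K) := by
      have := (PiLp.norm_apply_le (e z - EuclideanSpace.single 1 1) 0).trans_lt hz'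
      simpa using this
    have hz1 : |(e z) 1 - 1| < 1 / (1 + K) := by
      have := (PiLp.norm_apply_le (e z - EuclideanSpace.single 1 1) 1).trans_lt hz'
      simpa using this
    have hlip : |f ((e y) 0) - f ((e y) 0 - s * (e z) 0)| ≤ K * (s * |(e z) 0|) := by
      have := hf.dist_le_mul ((e y) 0) ((e y) 0 - s * (e z) 0)
      rwa [Real.dist_eq, Real.dist_eq, sub_sub_cancel, abs_mul, abs_of_pos hs] at this
    rw [map_sub, map_smul]
    simp only [PiLp.sub_apply, PiLp.smul_apply, smul_eq_mul]
    -- With `δ = 1/(1 + K)` one has `K δ = 1 - δ`, so moving along `-z` descends faster than the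
    -- graph can.
    have hK : (K : ℝ) * |(e z) 0| < (e z) 1 := by
      have hk0 := K.coe_nonneg
      have h3 : (K : ℝ) * |(e z) 0| ≤ K * (1 / (1 + K)) := by gcongr
      have h4 : (K : ℝ) * (1 / (1 + K)) = 1 - 1 / (1 + K) := by field_simp; ring
      have h5 := (abs_lt.1 hz1).1
      linarith
    have hK' := mul_lt_mul_of_pos_left hK hs
    have := (abs_le.1 hlip).2
    nlinarith
  · filter_upwards [hn] with x hx
    rw [hx, inner_slopeNormal, LinearIsometryEquiv.apply_symm_apply]
    have : |deriv f ((e x) 0)| ≤ K := norm_deriv_le_of_lipschitz hf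
    have h2 : deriv f ((e x) 0) ^ 2 ≤ (K : ℝ) ^ 2 := sq_le_sq.2 (this.trans (le_abs_self _))
    simp only [PiLp.single_apply]
    norm_num
    gcongr
  · obtain ⟨R, hR⟩ := hVb.subset_closedBall 0
    have hsub : Set.range (graphMap e f) ∩ V ⊆ graphMap e f '' Set.Icc (-R) R := by
      rintro _ ⟨⟨x, rfl⟩, hx⟩
      refine ⟨x, ?_, rfl⟩
      have h1 : ‖graphMap e f x‖ ≤ R := by simpa using hR hx
      have h2 := PiLp.norm_apply_le (e (graphMap e f x)) 0
      rw [LinearIsometryEquiv.norm_map, graphMap_apply_zero, Real.norm_eq_abs] at h2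
      exact abs_le.1 (h2.trans h1)
    have hlip : ∀ x y, |f x - f y - 0 * (x - y)| ≤ K * |x - y| := fun x y => by
      simpa [Real.dist_eq] using hf.dist_le_mul x y
    rw [← Measure.restrict_apply_self, bdryMeasure_restrict_eq e hV hf hΩ,
      ← hausdorffMeasure_restrict_range_graphMap e hf, Measure.restrict_apply_self,
      Measure.restrict_apply hV.measurableSet, Set.inter_comm]
    refine (measure_mono hsub).trans_lt ((hausdorffMeasure_graphMap_image_le e f K.coe_nonneg
      fun x _ y _ => hlip x y).trans_lt ?_)
    rw [Real.volume_Icc]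
    exact ENNReal.mul_lt_top ENNReal.ofReal_lt_top ENNReal.ofReal_lt_top
  · refine AEStronglyMeasurable.congr (f := fun y => slopeNormal e (deriv f ((e y) 0))) ?_
      (by filter_upwards [hn] with y hy using hy.symm)
    refine Measurable.aestronglyMeasurable ?_
    have h1 : Measurable fun y : Plane => (e y) 0 := by
      have : Continuous fun y : Plane => (e y) 0 := by fun_prop
      exact this.measurable
    exact (continuous_slopeNormal e).measurable.comp ((measurable_deriv f).comp h1)

end BoundaryChart

/-! ### Partition of unity -/

lemma IsLipschitzDomain.exists_isChart {Ω : Set Plane} (hΩ : IsLipschitzDomain Ω) {x : Plane}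
    (hx : x ∈ closure Ω) : ∃ V ν, x ∈ V ∧ IsChart Ω V ν := by
  by_cases hxΩ : x ∈ Ω
  · exact ⟨Ω, 0, hxΩ, isChart_self hΩ.isOpen hΩ.bounded 0⟩
  · obtain ⟨e, f, K, r, hf, hr, h⟩ := hΩ.graph x (by rw [hΩ.isOpen.frontier_eq]; exact ⟨hx, hxΩ⟩)
    exact ⟨Metric.ball x r, _, Metric.mem_ball_self hr,
      isChart_subgraph e Metric.isOpen_ball Metric.isBounded_ball hf hΩ.isOpen h⟩

open scoped Manifold ContDiff in
lemma IsLipschitzDomain.exists_partition {Ω : Set Plane} (hΩ : IsLipschitzDomain Ω) :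
    ∃ (ι : Type) (_ : Fintype ι) (V : ι → Set Plane) (ν : ι → Plane) (ψ : ι → Plane → ℝ),
      (∀ m, IsChart Ω (V m) (ν m)) ∧ (∀ m, ContDiff ℝ (⊤ : ℕ∞) (ψ m)) ∧
      (∀ m, HasCompactSupport (ψ m)) ∧ (∀ m, tsupport (ψ m) ⊆ V m) ∧ (∀ m x, 0 ≤ ψ m x) ∧
      (∀ x ∈ closure Ω, ∑ m, ψ m x = 1) ∧ closure Ω ⊆ ⋃ m, V m := by
  have hcomp : IsCompact (closure Ω) := hΩ.bounded.isCompact_closure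
  choose! V ν hxV hV using fun x (hx : x ∈ closure Ω) => hΩ.exists_isChart hx
  obtain ⟨t, ht, hcov⟩ := hcomp.elim_nhds_subcover V
    fun x hx => (hV x hx).isOpen.mem_nhds (hxV x hx)
  have hcov' : closure Ω ⊆ ⋃ m : Fin t.card, V (t.equivFin.symm m) := by
    intro x hx
    obtain ⟨y, hy, hxy⟩ := Set.mem_iUnion₂.1 (hcov hx)
    refine Set.mem_iUnion.2 ⟨t.equivFin ⟨y, hy⟩, ?_⟩
    simpa using hxy
  have hch : ∀ m : Fin t.card, IsChart Ω (V (t.equivFin.symm m)) (ν (t.equivFin.symm m)) :=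
    fun m => hV _ (ht _ (t.equivFin.symm m).2)
  obtain ⟨F, hF⟩ := SmoothPartitionOfUnity.exists_isSubordinate 𝓘(ℝ, Plane) isClosed_closure
    (fun m : Fin t.card => V (t.equivFin.symm m)) (fun m => (hch m).isOpen) hcov'
  refine ⟨Fin t.card, inferInstance, _, _, fun m => F m, hch, fun m => (F m).contMDiff.contDiff,
    fun m => ?_, hF, fun m x => F.nonneg m x, fun x hx => ?_, hcov'⟩
  · exact Metric.isCompact_of_isClosed_isBounded (isClosed_tsupport _)
      ((hch m).bounded.subset (hF m))
  · rw [← finsum_eq_sum_of_fintype]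
    exact F.sum_eq_one hx

lemma memLp_of_continuous {X : Type*} [TopologicalSpace X] [MeasurableSpace X]
    [OpensMeasurableSpace X] {μ : Measure X} [IsFiniteMeasure μ] {S : Set X} (hS : IsCompact S)
    (hμ : ∀ᵐ x ∂μ, x ∈ S) {g : X → ℝ} (hg : Continuous g) (p : ℝ≥0∞) : MemLp g p μ := by
  obtain ⟨C, hC⟩ := hS.exists_bound_of_continuousOn hg.continuousOn
  exact MemLp.of_bound hg.measurable.aestronglyMeasurable C (hμ.mono hC)

lemma toReal_eLpNorm_two_sq {α : Type*} [MeasurableSpace α] {μ : Measure α} {g : α → ℝ}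
    (hg : MemLp g 2 μ) : (eLpNorm g 2 μ).toReal ^ 2 = ∫ x, g x ^ 2 ∂μ := by
  have h0 : (0 : ℝ) ≤ ∫ x, g x ^ 2 ∂μ := integral_nonneg fun x => sq_nonneg _
  rw [hg.eLpNorm_eq_integral_rpow_norm two_ne_zero ENNReal.ofNat_ne_top,
    ENNReal.toReal_ofReal (by positivity)]
  simp only [ENNReal.toReal_ofNat, Real.rpow_two, Real.norm_eq_abs, sq_abs]
  rw [← Real.rpow_natCast, ← Real.rpow_mul h0]
  norm_num

/-! ### The global divergence theorem and the trace inequality -/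

section LipschitzDomain

variable {Ω : Set Plane} (hΩ : IsLipschitzDomain Ω)
include hΩ

lemma IsLipschitzDomain.volume_lt_top : volume Ω < ∞ := hΩ.bounded.measure_lt_top

lemma IsLipschitzDomain.isFiniteMeasure_restrict :
    IsFiniteMeasure ((volume : Measure Plane).restrict Ω) :=
  ⟨by simpa using hΩ.volume_lt_top⟩

lemma IsLipschitzDomain.ae_mem_closure :
    ∀ᵐ x ∂((volume : Measure Plane).restrict Ω), x ∈ closure Ω := by
  filter_upwards [ae_restrict_mem hΩ.isOpen.measurableSet] with x hx using subset_closure hx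

omit hΩ in
lemma ae_bdryMeasure_mem_frontier (Ω : Set Plane) : ∀ᵐ x ∂(bdryMeasure Ω), x ∈ frontier Ω :=
  ae_restrict_mem isClosed_frontier.measurableSet

omit hΩ in
lemma ae_bdryMeasure_mem_closure (Ω : Set Plane) : ∀ᵐ x ∂(bdryMeasure Ω), x ∈ closure Ω :=
  (ae_bdryMeasure_mem_frontier Ω).mono fun _ hx => frontier_subset_closure hx

lemma IsLipschitzDomain.isFiniteMeasure_bdryMeasure : IsFiniteMeasure (bdryMeasure Ω) := by
  obtain ⟨ι, _, V, ν, ψ, hV, -, -, -, -, -, hcov⟩ := hΩ.exists_partition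
  refine ⟨?_⟩
  have h1 : bdryMeasure Ω Set.univ ≤ bdryMeasure Ω (⋃ m, V m) := by
    refine measure_mono_ae ?_
    filter_upwards [ae_bdryMeasure_mem_closure Ω] with x hx _ using hcov hx
  refine h1.trans_lt ((measure_iUnion_le _).trans_lt ?_)
  rw [tsum_fintype]
  exact ENNReal.sum_lt_top.2 fun m _ => (hV m).finite

lemma IsLipschitzDomain.aestronglyMeasurable_outerNormal :
    AEStronglyMeasurable (outerNormal Ω) (bdryMeasure Ω) := by
  obtain ⟨ι, _, V, ν, ψ, hV, -, -, -, -, -, hcov⟩ := hΩ.exists_partition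
  have h1 : (bdryMeasure Ω).restrict (⋃ m, V m) = bdryMeasure Ω := by
    rw [Measure.restrict_eq_self_of_ae_mem]
    filter_upwards [ae_bdryMeasure_mem_closure Ω] with x hx using hcov hx
  rw [← h1, aestronglyMeasurable_iUnion_iff]
  exact fun m => (hV m).meas

lemma IsLipschitzDomain.memLp_restrict {g : Plane → ℝ} (hg : Continuous g) (p : ℝ≥0∞) :
    MemLp g p ((volume : Measure Plane).restrict Ω) :=
  have := hΩ.isFiniteMeasure_restrict
  memLp_of_continuous hΩ.bounded.isCompact_closure hΩ.ae_mem_closure hg p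

lemma IsLipschitzDomain.memLp_bdryMeasure {g : Plane → ℝ} (hg : Continuous g) (p : ℝ≥0∞) :
    MemLp g p (bdryMeasure Ω) :=
  have := hΩ.isFiniteMeasure_bdryMeasure
  memLp_of_continuous hΩ.bounded.isCompact_closure (ae_bdryMeasure_mem_closure Ω) hg p

lemma IsLipschitzDomain.integrableOn {g : Plane → ℝ} (hg : Continuous g) : IntegrableOn g Ω :=
  memLp_one_iff_integrable.1 (hΩ.memLp_restrict hg 1)

lemma IsLipschitzDomain.integrable_bdryMeasure {g : Plane → ℝ} (hg : Continuous g) :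
    Integrable g (bdryMeasure Ω) :=
  memLp_one_iff_integrable.1 (hΩ.memLp_bdryMeasure hg 1)

lemma IsLipschitzDomain.integrable_mul_inner_outerNormal {g : Plane → ℝ}
    (hg : Integrable g (bdryMeasure Ω)) (a : Plane) :
    Integrable (fun x => g x * inner ℝ a (outerNormal Ω x)) (bdryMeasure Ω) := by
  refine hg.mul_bdd (c := ‖a‖) ?_ (ae_of_all _ fun x => ?_)
  · exact aestronglyMeasurable_const.inner hΩ.aestronglyMeasurable_outerNormal
  · refine (norm_inner_le_norm _ _).trans ?_
    exact mul_le_of_le_one_right (norm_nonneg _) (norm_outerNormal_le Ω x)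

/-- The divergence theorem on a Lipschitz domain. -/
lemma IsLipschitzDomain.integral_fderiv {φ : Plane → ℝ} (hφ : ContDiff ℝ 1 φ) (a : Plane) :
    ∫ x in Ω, fderiv ℝ φ x a = ∫ x, φ x * inner ℝ a (outerNormal Ω x) ∂(bdryMeasure Ω) := by
  obtain ⟨ι, _, V, ν, ψ, hV, hψ, hψc, hψV, -, hψ1, -⟩ := hΩ.exists_partition
  have hψ' : ∀ m, ContDiff ℝ 1 (ψ m) := fun m => (hψ m).of_le (by exact_mod_cast le_top)
  have hm : ∀ m, ContDiff ℝ 1 fun x => ψ m x * φ x := fun m => (hψ' m).mul hφ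
  have h1 : ∀ x ∈ Ω, fderiv ℝ φ x a = ∑ m, fderiv ℝ (fun x => ψ m x * φ x) x a := by
    intro x hx
    have heq : φ =ᶠ[𝓝 x] fun x => ∑ m, ψ m x * φ x := by
      filter_upwards [hΩ.isOpen.mem_nhds hx] with y hy
      rw [← Finset.sum_mul, hψ1 y (subset_closure hy), one_mul]
    rw [heq.fderiv_eq, fderiv_fun_sum fun m _ => (hm m).differentiable one_ne_zero x,
      sum_apply]
  have h2 : ∀ m, ∫ x in Ω, fderiv ℝ (fun x => ψ m x * φ x) x a =
      ∫ x, ψ m x * φ x * inner ℝ a (outerNormal Ω x) ∂(bdryMeasure Ω) := fun m =>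
    (hV m).gauss _ (hm m) (hψc m).mul_right ((tsupport_mul_subset_left).trans (hψV m)) a
  rw [setIntegral_congr_fun hΩ.isOpen.measurableSet h1, integral_finsetSum]
  · simp only [h2]
    rw [← integral_finsetSum]
    · refine integral_congr_ae ?_
      filter_upwards [ae_bdryMeasure_mem_closure Ω] with x hx
      rw [← Finset.sum_mul, ← Finset.sum_mul, hψ1 x hx, one_mul]
    · exact fun m _ => hΩ.integrable_mul_inner_outerNormal
        (hΩ.integrable_bdryMeasure (hm m).continuous) a
  · exact fun m _ => (hΩ.integrableOn (((hm m).continuous_fderiv one_ne_zero).clm_apply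
      continuous_const))

omit hΩ in
lemma fderiv_apply_sq_le (φ : Plane → ℝ) (x a : Plane) :
    (fderiv ℝ φ x a) ^ 2 ≤ ‖a‖ ^ 2 * (pderiv 0 φ x ^ 2 + pderiv 1 φ x ^ 2) := by
  have ha : a = a 0 • EuclideanSpace.single 0 1 + a 1 • EuclideanSpace.single 1 1 := by
    ext i
    fin_cases i <;> simp
  have h : fderiv ℝ φ x a = a 0 * pderiv 0 φ x + a 1 * pderiv 1 φ x := by
    conv_lhs => rw [ha]
    simp [pderiv]
  rw [h, EuclideanSpace.norm_sq_eq, Fin.sum_univ_two, Real.norm_eq_abs, Real.norm_eq_abs, sq_abs,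
    sq_abs]
  nlinarith [sq_nonneg (a 0 * pderiv 1 φ x - a 1 * pderiv 0 φ x)]

omit hΩ in
lemma continuous_pderiv {φ : Plane → ℝ} (hφ : ContDiff ℝ 1 φ) (i : Fin 2) :
    Continuous (pderiv i φ) :=
  (hφ.continuous_fderiv one_ne_zero).clm_apply continuous_const

/-- The divergence theorem is applied to `ψ U²` in the direction `ν`. Transversality bounds the
boundary side below by `c ∮ ψ U²`; the interior side is controlled by `2 U ∂U ≤ U² + (∂U)²`. -/
lemma IsLipschitzDomain.exists_integral_sq_le_of_isChart {V : Set Plane} {ν : Plane}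
    (hV : IsChart Ω V ν) {ψ : Plane → ℝ} (hψ : ContDiff ℝ 1 ψ) (hψc : HasCompactSupport ψ)
    (hψV : tsupport ψ ⊆ V) (hψ0 : ∀ x, 0 ≤ ψ x) :
    ∃ C : ℝ, 0 ≤ C ∧ ∀ U : Plane → ℝ, ContDiff ℝ 1 U →
      ∫ x, ψ x * U x ^ 2 ∂(bdryMeasure Ω) ≤
        C * ∫ x in Ω, (U x ^ 2 + (pderiv 0 U x ^ 2 + pderiv 1 U x ^ 2)) := by
  obtain ⟨c, hc, hcν⟩ := hV.transversal
  obtain ⟨B₁, hB₁⟩ := hψc.exists_bound_of_continuous hψ.continuous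
  obtain ⟨B₂, hB₂⟩ := (hψc.fderiv_apply ℝ ν).exists_bound_of_continuous
    ((hψ.continuous_fderiv one_ne_zero).clm_apply continuous_const)
  have hB₁0 : 0 ≤ B₁ := (norm_nonneg _).trans (hB₁ 0)
  have hB₂0 : 0 ≤ B₂ := (norm_nonneg _).trans (hB₂ 0)
  -- `B₁` bounds `ψ`, `B₂` bounds its derivative along `ν`, and `‖ν‖²` comes from bounding that
  -- derivative of `U` by its partial derivatives.
  refine ⟨c⁻¹ * (B₂ + B₁ * (1 + ‖ν‖ ^ 2)), by positivity, fun U hU => ?_⟩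
  have hψU : ContDiff ℝ 1 fun x => ψ x * U x ^ 2 := hψ.mul (hU.pow 2)
  have hsupp : tsupport (fun x => ψ x * U x ^ 2) ⊆ V := tsupport_mul_subset_left.trans hψV
  have hg := hV.gauss _ hψU hψc.mul_right hsupp ν
  have hint : Integrable (fun x => ψ x * U x ^ 2) (bdryMeasure Ω) :=
    hΩ.integrable_bdryMeasure hψU.continuous
  have h1 : c * ∫ x, ψ x * U x ^ 2 ∂(bdryMeasure Ω) ≤
      ∫ x, ψ x * U x ^ 2 * inner ℝ ν (outerNormal Ω x) ∂(bdryMeasure Ω) := by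
    rw [← integral_const_mul]
    refine integral_mono_ae (hint.const_mul c) (hΩ.integrable_mul_inner_outerNormal hint ν) ?_
    filter_upwards [(ae_restrict_iff' hV.isOpen.measurableSet).1 hcν] with x hx
    by_cases hxV : x ∈ V
    · have := hx hxV
      have h0 : 0 ≤ ψ x * U x ^ 2 := mul_nonneg (hψ0 x) (sq_nonneg _)
      nlinarith
    · have : ψ x = 0 := image_eq_zero_of_notMem_tsupport fun h => hxV (hψV h)
      simp [this]
  have h2 : ∫ x in Ω, fderiv ℝ (fun x => ψ x * U x ^ 2) x ν ≤
      (B₂ + B₁ * (1 + ‖ν‖ ^ 2)) *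
        ∫ x in Ω, (U x ^ 2 + (pderiv 0 U x ^ 2 + pderiv 1 U x ^ 2)) := by
    rw [← integral_const_mul]
    refine integral_mono ?_ ?_ fun x => ?_
    · exact hΩ.integrableOn ((hψU.continuous_fderiv one_ne_zero).clm_apply
        continuous_const)
    · refine (hΩ.integrableOn ?_).const_mul _
      have := continuous_pderiv hU
      have := hU.continuous
      fun_prop
    · have hd : fderiv ℝ (fun x => ψ x * U x ^ 2) x ν =
          ψ x * (2 * U x * fderiv ℝ U x ν) + U x ^ 2 * fderiv ℝ ψ x ν := by
        rw [fderiv_fun_mul (hψ.differentiable one_ne_zero x)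
          ((hU.pow 2).differentiable one_ne_zero x),
          fderiv_fun_pow 2 (hU.differentiable one_ne_zero x)]
        simp
      have h3 := fderiv_apply_sq_le U x ν
      have h4 : fderiv ℝ ψ x ν ≤ B₂ := (le_abs_self _).trans (hB₂ x)
      have h5 : ψ x ≤ B₁ := (le_abs_self _).trans (hB₁ x)
      simp only [hd]
      set d := fderiv ℝ U x ν
      set P := pderiv 0 U x ^ 2 + pderiv 1 U x ^ 2 with hP
      have hP0 : 0 ≤ P := by positivity
      have h6 : ψ x * (2 * U x * d) ≤ B₁ * (U x ^ 2 + d ^ 2) := by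
        have h7 : 2 * U x * d ≤ U x ^ 2 + d ^ 2 := by nlinarith [sq_nonneg (U x - d)]
        have h8 : 0 ≤ U x ^ 2 + d ^ 2 := by positivity
        nlinarith [hψ0 x, mul_le_mul_of_nonneg_left h7 (hψ0 x), mul_le_mul_of_nonneg_right h5 h8]
      have h9 : U x ^ 2 * fderiv ℝ ψ x ν ≤ U x ^ 2 * B₂ := by gcongr
      have h10 : B₁ * d ^ 2 ≤ B₁ * (‖ν‖ ^ 2 * P) := by gcongr
      have h11 : 0 ≤ B₂ * P := by positivity
      have h12 : 0 ≤ B₁ * P := by positivity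
      have h13 : 0 ≤ B₁ * ‖ν‖ ^ 2 * U x ^ 2 := by positivity
      nlinarith
  rw [mul_assoc, ← div_eq_inv_mul, le_div_iff₀' hc]
  exact h1.trans (hg ▸ h2)

/-- The trace inequality for smooth functions. -/
lemma IsLipschitzDomain.exists_integral_sq_le :
    ∃ C : ℝ, 0 ≤ C ∧ ∀ U : Plane → ℝ, ContDiff ℝ 1 U →
      ∫ x, U x ^ 2 ∂(bdryMeasure Ω) ≤
        C * ∫ x in Ω, (U x ^ 2 + (pderiv 0 U x ^ 2 + pderiv 1 U x ^ 2)) := by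
  obtain ⟨ι, _, V, ν, ψ, hV, hψ, hψc, hψV, hψ0, hψ1, -⟩ := hΩ.exists_partition
  have hψ' : ∀ m, ContDiff ℝ 1 (ψ m) := fun m => (hψ m).of_le (by exact_mod_cast le_top)
  choose C hC0 hC using fun m =>
    hΩ.exists_integral_sq_le_of_isChart (hV m) (hψ' m) (hψc m) (hψV m) (hψ0 m)
  refine ⟨∑ m, C m, Finset.sum_nonneg fun m _ => hC0 m, fun U hU => ?_⟩
  have h1 : ∫ x, U x ^ 2 ∂(bdryMeasure Ω) = ∑ m, ∫ x, ψ m x * U x ^ 2 ∂(bdryMeasure Ω) := by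
    rw [← integral_finsetSum]
    · refine integral_congr_ae ?_
      filter_upwards [ae_bdryMeasure_mem_closure Ω] with x hx
      rw [← Finset.sum_mul, hψ1 x hx, one_mul]
    · exact fun m _ => hΩ.integrable_bdryMeasure
        ((hψ m).continuous.mul (hU.continuous.pow 2))
  rw [h1, Finset.sum_mul]
  exact Finset.sum_le_sum fun m _ => hC m U hU

lemma IsLipschitzDomain.exists_eLpNorm_le :
    ∃ C : NNReal, ∀ U : Plane → ℝ, ContDiff ℝ 1 U →
      eLpNorm U 2 (bdryMeasure Ω) ≤ C * (eLpNorm U 2 (volume.restrict Ω) +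
        ∑ i, eLpNorm (pderiv i U) 2 (volume.restrict Ω)) := by
  obtain ⟨C, hC0, hC⟩ := hΩ.exists_integral_sq_le
  refine ⟨Real.toNNReal √C, fun U hU => ?_⟩
  have hUb := hΩ.memLp_bdryMeasure hU.continuous 2
  have hUi := hΩ.memLp_restrict hU.continuous 2
  have hdi := fun i => hΩ.memLp_restrict (continuous_pderiv hU i) 2
  have h := hC U hU
  have hadd := integral_add hUi.integrable_sq ((hdi 0).integrable_sq.add (hdi 1).integrable_sq)
  simp only [Pi.add_apply] at hadd
  rw [hadd, integral_add (hdi 0).integrable_sq (hdi 1).integrable_sq, ← toReal_eLpNorm_two_sq hUb,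
    ← toReal_eLpNorm_two_sq hUi, ← toReal_eLpNorm_two_sq (hdi 0),
    ← toReal_eLpNorm_two_sq (hdi 1)] at h
  have hne := hUi.eLpNorm_ne_top
  have hne' := fun i => (hdi i).eLpNorm_ne_top
  rw [Fin.sum_univ_two, ← ENNReal.toReal_le_toReal hUb.eLpNorm_ne_top
    (ENNReal.mul_ne_top ENNReal.coe_ne_top (by simp [hne, hne'])), ENNReal.toReal_mul,
    ENNReal.toReal_add hne (by simp [hne']), ENNReal.toReal_add (hne' 0) (hne' 1),
    ENNReal.coe_toReal, Real.coe_toNNReal _ (Real.sqrt_nonneg _)]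
  -- Squaring reduces the claim to `a² + b² + d² ≤ (a + b + d)²` for nonnegative norms.
  refine abs_le_of_sq_le_sq' (h.trans ?_) (by positivity) |>.2
  rw [mul_pow, Real.sq_sqrt hC0]
  gcongr
  set a := (eLpNorm U 2 (volume.restrict Ω)).toReal with ha
  set b := (eLpNorm (pderiv 0 U) 2 (volume.restrict Ω)).toReal with hb
  set d := (eLpNorm (pderiv 1 U) 2 (volume.restrict Ω)).toReal with hd
  have ha0 : 0 ≤ a := ENNReal.toReal_nonneg
  have hb0 : 0 ≤ b := ENNReal.toReal_nonneg
  have hd0 : 0 ≤ d := ENNReal.toReal_nonneg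
  nlinarith [mul_nonneg ha0 hb0, mul_nonneg ha0 hd0, mul_nonneg hb0 hd0]

end LipschitzDomain

/-! ### Mollification in `L²` -/

section Mollify

variable {E : Type*} [NormedAddCommGroup E] [InnerProductSpace ℝ E] [FiniteDimensional ℝ E]
  [MeasurableSpace E] [BorelSpace E]

lemma tendsto_eLpNorm_translate_sub {w : E → ℝ} (hw : MemLp w 2 volume) :
    Tendsto (fun z => eLpNorm (fun y => w (y - z) - w y) 2 volume) (𝓝 0) (𝓝 0) := by
  have hmp : ∀ z : E, MeasurePreserving (fun y : E => y - z) volume volume :=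
    fun z => measurePreserving_sub_right volume z
  let G : C(E, C(E, E)) := ContinuousMap.curry ⟨fun p : E × E => p.2 - p.1, by fun_prop⟩
  have hG : ∀ z, MeasurePreserving (G z) (volume : Measure E) volume := hmp
  have h := (Filter.Tendsto.compMeasurePreservingLp (l := 𝓝 (0 : E)) (p := 2)
    (tendsto_const_nhds (x := hw.toLp w)) (G.continuous.tendsto 0) hG (hG 0) (by simp))
  rw [tendsto_iff_edist_tendsto_0] at h
  refine h.congr fun z => ?_
  rw [Lp.toLp_compMeasurePreserving, Lp.toLp_compMeasurePreserving, Lp.edist_toLp_toLp]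
  refine congrArg (fun g => eLpNorm g 2 volume) ?_
  ext y
  simp [G]

/-- A mollification is no farther from `w` than the translates of `w` which it averages. -/
lemma eLpNorm_convolution_sub_le {η w : E → ℝ} (hη : Continuous η) (hηc : HasCompactSupport η)
    (hη0 : ∀ x, 0 ≤ η x) (hη1 : ∫ x, η x = 1) (hw : MemLp w 2 volume) (hwm : Measurable w)
    {ε : ℝ≥0∞} (hε : ∀ z ∈ Function.support η,
      eLpNorm (fun y => w (y - z) - w y) 2 volume ≤ ε) :
    eLpNorm (fun y => convolution η w (ContinuousLinearMap.lsmul ℝ ℝ) volume y - w y) 2 volume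
      ≤ ε := by
  have hηi : Integrable η := hη.integrable_of_hasCompactSupport hηc
  -- As `η` is a probability density, the error is an average of `w (y - z) - w y`. Jensen's
  -- inequality, in the form `L¹ ≤ L²` for `κ`, and Tonelli then give the bound.
  set κ : Measure E := volume.withDensity fun z => ENNReal.ofReal (η z) with hκ
  have hηm : Measurable fun z => ENNReal.ofReal (η z) := hη.measurable.ennreal_ofReal
  have hκ1 : IsProbabilityMeasure κ := by
    refine ⟨?_⟩
    rw [hκ, withDensity_apply _ MeasurableSet.univ, Measure.restrict_univ,
      ← ofReal_integral_eq_lintegral_ofReal hηi (ae_of_all _ hη0), hη1, ENNReal.ofReal_one]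
  have hex : ConvolutionExists η w (ContinuousLinearMap.lsmul ℝ ℝ) volume :=
    hηc.convolutionExists_left _ hη (hw.locallyIntegrable one_le_two)
  have hF : Measurable (fun p : E × E => ‖w (p.1 - p.2) - w p.1‖ₑ) := by fun_prop
  have hpt : ∀ y, ‖convolution η w (ContinuousLinearMap.lsmul ℝ ℝ) volume y - w y‖ₑ ^ 2 ≤
      ∫⁻ z, ‖w (y - z) - w y‖ₑ ^ 2 ∂κ := by
    intro y
    have h1 : convolution η w (ContinuousLinearMap.lsmul ℝ ℝ) volume y - w y =
        ∫ z, η z * (w (y - z) - w y) := by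
      have h2 : w y = ∫ z, η z * w y := by rw [integral_mul_const, hη1, one_mul]
      have h3 := (hex y).integrable
      simp only [ContinuousLinearMap.lsmul_apply, smul_eq_mul] at h3
      rw [convolution_lsmul]
      conv_lhs => rw [h2]
      simp only [smul_eq_mul]
      rw [← integral_sub h3 (hηi.mul_const _)]
      simp only [mul_sub]
    have h4 : ‖convolution η w (ContinuousLinearMap.lsmul ℝ ℝ) volume y - w y‖ₑ ≤
        ∫⁻ z, ‖w (y - z) - w y‖ₑ ∂κ := by
      rw [h1]
      refine (enorm_integral_le_lintegral_enorm _).trans_eq ?_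
      rw [hκ, lintegral_withDensity_eq_lintegral_mul _ hηm (by fun_prop)]
      refine lintegral_congr fun z => ?_
      rw [enorm_mul, Pi.mul_apply, Real.enorm_of_nonneg (hη0 z)]
    have h5 := eLpNorm_le_eLpNorm_of_exponent_le (μ := κ) (p := 1) (q := 2)
      (f := fun z => w (y - z) - w y) one_le_two
      (by exact Measurable.aestronglyMeasurable (by fun_prop))
    rw [eLpNorm_one_eq_lintegral_enorm] at h5
    calc _ ≤ eLpNorm (fun z => w (y - z) - w y) 2 κ ^ 2 := by gcongr; exact h4.trans h5
      _ = _ := by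
        have := eLpNorm_nnreal_pow_eq_lintegral (μ := κ) (f := fun z => w (y - z) - w y)
          (p := 2) two_ne_zero
        simpa using this
  have hsq : ∀ g : E → ℝ, eLpNorm g 2 volume ^ 2 = ∫⁻ y, ‖g y‖ₑ ^ 2 := fun g => by
    have := eLpNorm_nnreal_pow_eq_lintegral (μ := volume) (f := g) (p := 2) two_ne_zero
    simpa using this
  rw [← ENNReal.pow_le_pow_left_iff two_ne_zero, hsq]
  calc _ ≤ ∫⁻ y, ∫⁻ z, ‖w (y - z) - w y‖ₑ ^ 2 ∂κ := lintegral_mono hpt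
    _ = ∫⁻ z, (∫⁻ y, ‖w (y - z) - w y‖ₑ ^ 2) ∂κ :=
        lintegral_lintegral_swap (hF.pow_const 2).aemeasurable
    _ ≤ ∫⁻ z, ε ^ 2 ∂κ := by
        refine lintegral_mono_ae ?_
        rw [hκ, ae_withDensity_iff hηm]
        refine ae_of_all _ fun z hz => ?_
        rw [← hsq]
        gcongr
        refine hε z fun h0 => hz ?_
        simp [h0]
    _ = ε ^ 2 := by simp

/-- Mollifiers which are supported in small balls around points converging to the origin. -/
lemma tendsto_eLpNorm_convolution_sub {η : ℕ → E → ℝ} (hη : ∀ k, Continuous (η k))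
    (hηc : ∀ k, HasCompactSupport (η k)) (hη0 : ∀ k x, 0 ≤ η k x) (hη1 : ∀ k, ∫ x, η k x = 1)
    (hηs : Tendsto (fun k => Function.support (η k)) atTop (𝓝 0).smallSets)
    {w : E → ℝ} (hw : MemLp w 2 volume) (hwm : Measurable w) :
    Tendsto (fun k => eLpNorm (fun y =>
      convolution (η k) w (ContinuousLinearMap.lsmul ℝ ℝ) volume y - w y) 2 volume)
      atTop (𝓝 0) := by
  rw [ENNReal.tendsto_nhds_zero]
  intro ε hε
  have h1 := ENNReal.tendsto_nhds_zero.1 (tendsto_eLpNorm_translate_sub hw) ε hε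
  filter_upwards [hηs.eventually (eventually_smallSets_forall.2 h1)] with k hk
  exact eLpNorm_convolution_sub_le (hη k) (hηc k) (hη0 k) (hη1 k) hw hwm hk

end Mollify

/-! ### Density of smooth functions in `H¹(Ω)` -/

lemma pderiv_convolution {η w : Plane → ℝ} (hη : ContDiff ℝ 1 η) (hηc : HasCompactSupport η)
    (hw : LocallyIntegrable w volume) (i : Fin 2) (y : Plane) :
    pderiv i (convolution η w (ContinuousLinearMap.lsmul ℝ ℝ) volume) y =
      ∫ x, pderiv i η (y - x) * w x := by
  rw [pderiv, (hηc.hasFDerivAt_convolution_left _ hη hw y).fderiv, convolution_eq_swap,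
    ContinuousLinearMap.integral_apply]
  · rfl
  · exact ((hηc.fderiv ℝ).convolutionExists_left _ (hη.continuous_fderiv one_ne_zero)
      hw y).integrable_swap

/-- The supports are shrinking balls centred off the origin, at multiples of `ν`. Convolution at `y`
then samples only points `y - s • z` with `z` near `ν`, which the cone condition keeps in `Ω`. -/
lemma exists_mollifiers (ν : Plane) {δ : ℝ} (hδ : 0 < δ) :
    ∃ η : ℕ → Plane → ℝ, (∀ k, ContDiff ℝ (⊤ : ℕ∞) (η k)) ∧ (∀ k, HasCompactSupport (η k)) ∧
      (∀ k x, 0 ≤ η k x) ∧ (∀ k, ∫ x, η k x = 1) ∧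
      ∀ k : ℕ, ∀ x ∈ tsupport (η k), ∃ z ∈ Metric.ball ν δ, x = (1 / ((k : ℝ) + 1)) • z := by
  have hs : ∀ k : ℕ, 0 < 1 / ((k : ℝ) + 1) := fun k => Nat.one_div_pos_of_nat
  let b : ∀ k : ℕ, ContDiffBump ((1 / ((k : ℝ) + 1)) • ν) := fun k =>
    ⟨1 / ((k : ℝ) + 1) * δ / 4, 1 / ((k : ℝ) + 1) * δ / 2,
      by have := hs k; positivity, by have := mul_pos (hs k) hδ; linarith⟩
  refine ⟨fun k => (b k).normed volume, fun k => (b k).contDiff_normed,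
    fun k => (b k).hasCompactSupport_normed, fun k x => (b k).nonneg_normed x,
    fun k => (b k).integral_normed, fun k x hx => ?_⟩
  rw [(b k).tsupport_normed_eq, mem_closedBall_iff_norm] at hx
  have hk := hs k
  refine ⟨((k : ℝ) + 1) • x, ?_, ?_⟩
  · have h1 : ((k : ℝ) + 1) • x - ν = ((k : ℝ) + 1) • (x - (1 / ((k : ℝ) + 1)) • ν) := by
      rw [smul_sub, smul_smul, mul_one_div_cancel (by positivity), one_smul]
    rw [mem_ball_iff_norm, h1, norm_smul, Real.norm_of_nonneg (by positivity)]
    calc _ ≤ ((k : ℝ) + 1) * (1 / ((k : ℝ) + 1) * δ / 2) := by gcongr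
      _ < δ := by field_simp; norm_num
  · rw [smul_smul, one_div_mul_cancel (by positivity), one_smul]

lemma tendsto_smul_ball_smallSets (ν : Plane) (δ : ℝ) {S : ℕ → Set Plane}
    (hS : ∀ k : ℕ, ∀ x ∈ S k, ∃ z ∈ Metric.ball ν δ, x = (1 / ((k : ℝ) + 1)) • z) :
    Tendsto S atTop (𝓝 (0 : Plane)).smallSets := by
  rw [tendsto_smallSets_iff]
  intro t ht
  obtain ⟨r, hr, hrt⟩ := Metric.mem_nhds_iff.1 ht
  have h1 : Tendsto (fun k : ℕ => 1 / ((k : ℝ) + 1) * (‖ν‖ + δ)) atTop (𝓝 0) := by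
    simpa using tendsto_one_div_add_atTop_nhds_zero_nat.mul_const (‖ν‖ + δ)
  filter_upwards [h1.eventually_lt_const hr] with k hk
  rintro x hx
  obtain ⟨z, hz, rfl⟩ := hS k x hx
  refine hrt (mem_ball_zero_iff.2 (lt_of_le_of_lt ?_ hk))
  have hz' : ‖z‖ ≤ ‖ν‖ + δ := by
    have := norm_le_norm_add_norm_sub' z ν
    have := mem_ball_iff_norm.1 hz
    linarith
  rw [norm_smul, Real.norm_of_nonneg (by positivity)]
  gcongr

lemma pderiv_mul {φ ψ : Plane → ℝ} {x : Plane} (hφ : DifferentiableAt ℝ φ x)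
    (hψ : DifferentiableAt ℝ ψ x) (i : Fin 2) :
    pderiv i (fun x => φ x * ψ x) x = φ x * pderiv i ψ x + ψ x * pderiv i φ x := by
  simp [pderiv, fderiv_fun_mul hφ hψ]

lemma pderiv_comp_sub {φ : Plane → ℝ} (hφ : Differentiable ℝ φ) (i : Fin 2) (y x : Plane) :
    pderiv i (fun x => φ (y - x)) x = -pderiv i φ (y - x) := by
  have h := (hφ (y - x)).hasFDerivAt.comp x ((hasFDerivAt_id x).const_sub y)
  have h' : HasFDerivAt (fun x => φ (y - x)) _ x := h
  rw [pderiv, h'.fderiv]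
  simp [pderiv]

lemma IsLipschitzDomain.integrableOn_L2_mul {Ω : Set Plane} (hΩ : IsLipschitzDomain Ω)
    (u : L2 Ω) {g : Plane → ℝ} (hg : Continuous g) : IntegrableOn (fun x => u x * g x) Ω :=
  MemLp.integrable_mul (Lp.memLp u) (hΩ.memLp_restrict hg 2)

/-- The product rule for weak derivatives, tested against a mollifier. -/
lemma HasWeakPartial.integral_mul_pderiv_sub {Ω : Set Plane} (hΩ : IsLipschitzDomain Ω)
    {i : Fin 2} {u g : L2 Ω} (h : HasWeakPartial Ω i u g) {ψ η : Plane → ℝ}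
    (hψ : ContDiff ℝ (⊤ : ℕ∞) ψ) (hψc : HasCompactSupport ψ) (hη : ContDiff ℝ (⊤ : ℕ∞) η)
    {y : Plane} (hy : ∀ x ∈ tsupport ψ, y - x ∈ tsupport η → x ∈ Ω) :
    ∫ x in Ω, pderiv i η (y - x) * (ψ x * u x) =
      ∫ x in Ω, η (y - x) * (ψ x * g x + pderiv i ψ x * u x) := by
  have hne : ((⊤ : ℕ∞) : WithTop ℕ∞) ≠ 0 := by simp
  have hψ1 : ContDiff ℝ 1 ψ := hψ.of_le (by exact_mod_cast le_top)
  have hη1 : ContDiff ℝ 1 η := hη.of_le (by exact_mod_cast le_top)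
  have hηy : ContDiff ℝ (⊤ : ℕ∞) fun x => η (y - x) := hη.comp (contDiff_const.sub contDiff_id)
  have hΦ : ContDiff ℝ (⊤ : ℕ∞) fun x => ψ x * η (y - x) := hψ.mul hηy
  -- This is where `hy` enters: it makes `x ↦ ψ x * η (y - x)` an admissible test function in `Ω`.
  have hsub : tsupport (fun x => ψ x * η (y - x)) ⊆ Ω := by
    intro x hx
    refine hy x (tsupport_mul_subset_left hx) ?_
    have h1 : x ∈ tsupport fun x => η (y - x) := tsupport_mul_subset_right hx
    exact tsupport_comp_subset_preimage η (continuous_const.sub continuous_id) h1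
  have hweak := h _ hΦ hψc.mul_right hsub
  have hd : ∀ x, pderiv i (fun x => ψ x * η (y - x)) x =
      ψ x * -pderiv i η (y - x) + η (y - x) * pderiv i ψ x := fun x => by
    rw [pderiv_mul (hψ.differentiable hne x) (hηy.differentiable hne x),
      pderiv_comp_sub (hη.differentiable hne)]
  have hc1 := continuous_pderiv hψ1 i
  have hc2 : Continuous fun x => pderiv i η (y - x) :=
    (continuous_pderiv hη1 i).comp (continuous_const.sub continuous_id)
  have hc3 := hηy.continuous
  have hc4 := hψ.continuous
  have hi1 : IntegrableOn (fun x => u x * (ψ x * pderiv i η (y - x))) Ω :=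
    hΩ.integrableOn_L2_mul u (hc4.mul hc2)
  have hi2 : IntegrableOn (fun x => u x * (η (y - x) * pderiv i ψ x)) Ω :=
    hΩ.integrableOn_L2_mul u (hc3.mul hc1)
  have hi3 : IntegrableOn (fun x => g x * (ψ x * η (y - x))) Ω :=
    hΩ.integrableOn_L2_mul g (hc4.mul hc3)
  have e1 : ∫ x in Ω, u x * pderiv i (fun x => ψ x * η (y - x)) x =
      (∫ x in Ω, u x * (η (y - x) * pderiv i ψ x)) -
        ∫ x in Ω, u x * (ψ x * pderiv i η (y - x)) := by
    rw [← integral_sub hi2 hi1]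
    congr 1
    ext x
    rw [hd]
    ring
  rw [e1] at hweak
  calc _ = ∫ x in Ω, u x * (ψ x * pderiv i η (y - x)) := by
        congr 1
        ext x
        ring
    _ = (∫ x in Ω, g x * (ψ x * η (y - x))) + ∫ x in Ω, u x * (η (y - x) * pderiv i ψ x) := by
        linarith
    _ = _ := by
        rw [← integral_add hi3 hi2]
        congr 1
        ext x
        ring

lemma IsLipschitzDomain.memLp_indicator_mul {Ω : Set Plane} (hΩ : IsLipschitzDomain Ω)
    (u : L2 Ω) {ψ : Plane → ℝ} (hψ : Continuous ψ) :
    MemLp (Ω.indicator fun x => ψ x * u x) 2 volume := by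
  rw [memLp_indicator_iff_restrict hΩ.isOpen.measurableSet]
  have := MemLp.mul (p := ∞) (q := 2) (r := 2) (Lp.memLp u) (hΩ.memLp_restrict hψ ∞)
  exact this

/-- Smooth approximation in `H¹(Ω)` of a function which is localized to a chart. -/
lemma IsChart.exists_smooth_approx {Ω V : Set Plane} {ν : Plane} (hΩ : IsLipschitzDomain Ω)
    (hV : IsChart Ω V ν) {ψ : Plane → ℝ} (hψ : ContDiff ℝ (⊤ : ℕ∞) ψ)
    (hψc : HasCompactSupport ψ) (hψV : tsupport ψ ⊆ V) {u : L2 Ω} {g : Fin 2 → L2 Ω}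
    (hu : ∀ i, HasWeakPartial Ω i u (g i)) :
    ∃ U : ℕ → Plane → ℝ, (∀ k, ContDiff ℝ (⊤ : ℕ∞) (U k)) ∧
      Tendsto (fun k => eLpNorm (fun x => U k x - ψ x * u x) 2 (volume.restrict Ω)) atTop (𝓝 0) ∧
      ∀ i, Tendsto (fun k => eLpNorm
        (fun x => pderiv i (U k) x - (ψ x * g i x + pderiv i ψ x * u x)) 2
        (volume.restrict Ω)) atTop (𝓝 0) := by
  obtain ⟨δ, hδ, hcone⟩ := hV.cone
  obtain ⟨η, hη, hηc, hη0, hη1, hηs⟩ := exists_mollifiers ν hδ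
  have hψ1 : ContDiff ℝ 1 ψ := hψ.of_le (by exact_mod_cast le_top)
  have hη1' : ∀ k, ContDiff ℝ 1 (η k) := fun k => (hη k).of_le (by exact_mod_cast le_top)
  have hΩm := hΩ.isOpen.measurableSet
  have hum : Measurable fun x => u x := (Lp.stronglyMeasurable u).measurable
  have hgm : ∀ i, Measurable fun x => g i x := fun i => (Lp.stronglyMeasurable (g i)).measurable
  have hψm := hψ.continuous.measurable
  have hdψm := fun i => (continuous_pderiv hψ1 i).measurable
  -- Extensions by zero of `ψ u` and of its weak gradient. In general `w'` is not the gradient of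
  -- `w` across the boundary; only derivatives of the convolution at points of `Ω` matter.
  set w : Plane → ℝ := Ω.indicator fun x => ψ x * u x with hw
  set w' : Fin 2 → Plane → ℝ := fun i =>
    Ω.indicator fun x => ψ x * g i x + pderiv i ψ x * u x with hw'
  have hwL : MemLp w 2 volume := hΩ.memLp_indicator_mul u hψ.continuous
  have hwL' : ∀ i, MemLp (w' i) 2 volume := fun i => by
    have := (hΩ.memLp_indicator_mul (g i) hψ.continuous).add
      (hΩ.memLp_indicator_mul u (continuous_pderiv hψ1 i))
    rw [← Set.indicator_add'] at this
    exact this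
  have hwm : Measurable w := (hψm.mul hum).indicator hΩm
  have hwm' : ∀ i, Measurable (w' i) := fun i =>
    ((hψm.mul (hgm i)).add ((hdψm i).mul hum)).indicator hΩm
  have hwloc : LocallyIntegrable w volume := hwL.locallyIntegrable one_le_two
  have hsupp : Tendsto (fun k => tsupport (η k)) atTop (𝓝 (0 : Plane)).smallSets :=
    tendsto_smul_ball_smallSets ν δ hηs
  have hsupp' : Tendsto (fun k => Function.support (η k)) atTop (𝓝 (0 : Plane)).smallSets :=
    tendsto_smul_ball_smallSets ν δ fun k x hx => hηs k x (subset_tsupport _ hx)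
  have hrestrict : ∀ F G : Plane → ℝ, eLpNorm (fun x => F x - G x) 2 (volume.restrict Ω) ≤
      eLpNorm (fun x => F x - Ω.indicator G x) 2 volume := fun F G => by
    refine le_trans (le_of_eq (eLpNorm_congr_ae ?_)) (eLpNorm_restrict_le _ _ _ _)
    filter_upwards [ae_restrict_mem hΩm] with x hx
    rw [Set.indicator_of_mem hx]
  have hcontη := fun k => (hη k).continuous
  refine ⟨fun k => convolution (η k) w (ContinuousLinearMap.lsmul ℝ ℝ) volume, fun k =>
    (hηc k).contDiff_convolution_left _ (hη k) hwloc, ?_, fun i => ?_⟩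
  · refine tendsto_of_tendsto_of_tendsto_of_le_of_le tendsto_const_nhds
      (tendsto_eLpNorm_convolution_sub hcontη hηc hη0 hη1 hsupp' hwL hwm) (fun _ => zero_le)
      fun k => hrestrict _ _
  -- Once the mollifier is supported in the ball of radius `r`, any `y` whose convolution meets the
  -- support of `ψ` lies in `V`, so the cone condition is available.
  · obtain ⟨r, hr, hrV⟩ := hψc.isCompact.exists_thickening_subset_open hV.isOpen hψV
    have hev := hsupp.eventually
      (eventually_smallSets_forall.2 (Metric.ball_mem_nhds (0 : Plane) hr))
    refine tendsto_of_tendsto_of_tendsto_of_le_of_le' tendsto_const_nhds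
      (tendsto_eLpNorm_convolution_sub hcontη hηc hη0 hη1 hsupp' (hwL' i) (hwm' i))
      (Eventually.of_forall fun _ => zero_le) ?_
    filter_upwards [hev] with k hk
    refine le_trans (le_of_eq (eLpNorm_congr_ae ?_)) (hrestrict _ _)
    filter_upwards [ae_restrict_mem hΩm] with y hy
    congr 1
    have hkey : ∀ x ∈ tsupport ψ, y - x ∈ tsupport (η k) → x ∈ Ω := by
      intro x hx hyx
      obtain ⟨z, hz, hyz⟩ := hηs k _ hyx
      have hx' : x = y - (1 / ((k : ℝ) + 1)) • z := by rw [← hyz, sub_sub_cancel]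
      have hyV : y ∈ V := by
        refine hrV (Metric.mem_thickening_iff.2 ⟨x, hx, ?_⟩)
        rw [dist_eq_norm]
        exact mem_ball_zero_iff.1 (hk _ hyx)
      rw [hx']
      refine hcone y hy hyV z hz _ (by positivity) ?_
      rw [← hx']
      exact hψV hx
    rw [pderiv_convolution (hη1' k) (hηc k) hwloc, convolution_eq_swap]
    have e1 : ∀ x, pderiv i (η k) (y - x) * w x =
        Ω.indicator (fun x => pderiv i (η k) (y - x) * (ψ x * u x)) x := fun x => by
      by_cases hx : x ∈ Ω <;> simp [hw, hx]
    have e2 : ∀ x, (ContinuousLinearMap.lsmul ℝ ℝ) (η k (y - x)) (w' i x) =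
        Ω.indicator (fun x => η k (y - x) * (ψ x * g i x + pderiv i ψ x * u x)) x := fun x => by
      by_cases hx : x ∈ Ω <;> simp [hw', hx]
    simp only [e1]
    rw [integral_indicator hΩm, (hu i).integral_mul_pderiv_sub hΩ hψ hψc (hη k) hkey,
      ← integral_indicator hΩm]
    exact integral_congr_ae (ae_of_all _ fun x => (e2 x).symm)

lemma tendsto_eLpNorm_finset_sum {α ι : Type*} [Fintype ι] [MeasurableSpace α] {μ : Measure α}
    {F : ι → ℕ → α → ℝ} (hF : ∀ m k, AEStronglyMeasurable (F m k) μ)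
    (h : ∀ m, Tendsto (fun k => eLpNorm (F m k) 2 μ) atTop (𝓝 0)) :
    Tendsto (fun k => eLpNorm (∑ m, F m k) 2 μ) atTop (𝓝 0) := by
  have h1 : Tendsto (fun k => ∑ m, eLpNorm (F m k) 2 μ) atTop (𝓝 0) := by
    simpa using tendsto_finsetSum Finset.univ fun m _ => h m
  exact tendsto_of_tendsto_of_tendsto_of_le_of_le tendsto_const_nhds h1 (fun _ => zero_le)
    fun k => eLpNorm_sum_le (fun m _ => hF m k) one_le_two

/-- Functions which are smooth on the whole plane are dense in `H¹(Ω)`. -/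
lemma IsLipschitzDomain.exists_smooth_approx {Ω : Set Plane} (hΩ : IsLipschitzDomain Ω) {u : L2 Ω}
    {g : Fin 2 → L2 Ω} (hu : ∀ i, HasWeakPartial Ω i u (g i)) :
    ∃ U : ℕ → Plane → ℝ, (∀ k, ContDiff ℝ (⊤ : ℕ∞) (U k)) ∧
      Tendsto (fun k => eLpNorm (fun x => U k x - u x) 2 (volume.restrict Ω)) atTop (𝓝 0) ∧
      ∀ i, Tendsto (fun k => eLpNorm (fun x => pderiv i (U k) x - g i x) 2
        (volume.restrict Ω)) atTop (𝓝 0) := by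
  obtain ⟨ι, _, V, ν, ψ, hV, hψ, hψc, hψV, -, hψ1, -⟩ := hΩ.exists_partition
  choose U hU hU0 hU1 using fun m => (hV m).exists_smooth_approx hΩ (hψ m) (hψc m) (hψV m) hu
  have hne : ((⊤ : ℕ∞) : WithTop ℕ∞) ≠ 0 := by simp
  have hψ' : ∀ m, ContDiff ℝ 1 (ψ m) := fun m => (hψ m).of_le (by exact_mod_cast le_top)
  have hU' : ∀ m k, ContDiff ℝ 1 (U m k) := fun m k => (hU m k).of_le (by exact_mod_cast le_top)
  have hΩm := hΩ.isOpen.measurableSet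
  have hum : Measurable fun x => u x := (Lp.stronglyMeasurable u).measurable
  have hgm : ∀ i, Measurable fun x => g i x := fun i => (Lp.stronglyMeasurable (g i)).measurable
  refine ⟨fun k x => ∑ m, U m k x, fun k => ContDiff.sum fun m _ => hU m k, ?_, fun i => ?_⟩
  · refine (tendsto_eLpNorm_finset_sum (fun m k => ?_) hU0).congr fun k => eLpNorm_congr_ae ?_
    · exact (((hU m k).continuous.measurable).sub
        ((hψ m).continuous.measurable.mul hum)).aestronglyMeasurable
    · filter_upwards [ae_restrict_mem hΩm] with x hx
      rw [Finset.sum_apply, Finset.sum_sub_distrib, ← Finset.sum_mul, hψ1 x (subset_closure hx),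
        one_mul]
  · refine (tendsto_eLpNorm_finset_sum (fun m k => ?_) fun m => hU1 m i).congr
      fun k => eLpNorm_congr_ae ?_
    · have h1 := (continuous_pderiv (hU' m k) i).measurable
      have h2 := (continuous_pderiv (hψ' m) i).measurable
      have h3 := (hψ m).continuous.measurable
      have h4 := hgm i
      exact Measurable.aestronglyMeasurable (by fun_prop)
    · filter_upwards [ae_restrict_mem hΩm] with x hx
      -- The partition of unity is constant near `x`, so the cut-off terms of the product rule
      -- cancel.
      have hsum0 : ∑ m, pderiv i (ψ m) x = 0 := by
        have heq : (fun y => ∑ m, ψ m y) =ᶠ[𝓝 x] fun _ => (1 : ℝ) := by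
          filter_upwards [hΩ.isOpen.mem_nhds hx] with y hy using hψ1 y (subset_closure hy)
        have h5 := heq.fderiv_eq (𝕜 := ℝ)
        rw [fderiv_fun_sum fun m _ => (hψ m).differentiable hne x] at h5
        have h6 := congrArg (fun L => L (EuclideanSpace.single i 1)) h5
        simpa [pderiv] using h6
      have hsumU : pderiv i (fun x => ∑ m, U m k x) x = ∑ m, pderiv i (U m k) x := by
        simp [pderiv, fderiv_fun_sum fun m _ => (hU m k).differentiable hne x]
      rw [Finset.sum_apply, Finset.sum_sub_distrib, Finset.sum_add_distrib, ← Finset.sum_mul,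
        ← Finset.sum_mul, hψ1 x (subset_closure hx), hsum0, hsumU]
      ring

/-! ### Weak derivatives and the `L²` pairing -/

section WeakPartial

variable {Ω : Set Plane} {i : Fin 2} {u g g' : L2 Ω}

lemma MemH1.hasWeakPartial (h : MemH1 Ω u) (i : Fin 2) :
    HasWeakPartial Ω i u (weakPartial Ω i u) := by
  rw [weakPartial, dif_pos (h i)]
  exact (h i).choose_spec

lemma HasWeakPartial.neg (h : HasWeakPartial Ω i u g) : HasWeakPartial Ω i (-u) (-g) := by
  intro φ hφ hc hs
  have h1 : ∫ x in Ω, (-u) x * pderiv i φ x = -∫ x in Ω, u x * pderiv i φ x := by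
    rw [← integral_neg]
    refine integral_congr_ae ?_
    filter_upwards [Lp.coeFn_neg u] with x hx
    rw [hx, Pi.neg_apply, neg_mul]
  have h2 : ∫ x in Ω, (-g) x * φ x = -∫ x in Ω, g x * φ x := by
    rw [← integral_neg]
    refine integral_congr_ae ?_
    filter_upwards [Lp.coeFn_neg g] with x hx
    rw [hx, Pi.neg_apply, neg_mul]
  rw [h1, h2, h φ hφ hc hs]

/-- The fundamental lemma of the calculus of variations. It makes the chosen `weakPartial`
compatible with negation. -/
lemma HasWeakPartial.unique (hΩ : IsLipschitzDomain Ω) (h : HasWeakPartial Ω i u g)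
    (h' : HasWeakPartial Ω i u g') : g = g' := by
  have := hΩ.isFiniteMeasure_restrict
  have hint : ∀ w : L2 Ω, Integrable (fun x => w x) (volume.restrict Ω) := fun w =>
    (Lp.memLp w).integrable one_le_two
  have h0 := hΩ.isOpen.ae_eq_zero_of_integral_contDiff_smul_eq_zero (μ := volume.restrict Ω)
    (f := fun x => g x - g' x) (((hint g).sub (hint g')).locallyIntegrable.locallyIntegrableOn _)
    fun φ hφ hc hs => by
      have e1 := h φ hφ hc hs
      have e2 := h' φ hφ hc hs
      have hi1 := hΩ.integrableOn_L2_mul g hφ.continuous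
      have hi2 := hΩ.integrableOn_L2_mul g' hφ.continuous
      calc _ = ∫ x in Ω, (g x * φ x - g' x * φ x) := by
            congr 1
            ext x
            rw [smul_eq_mul]
            ring
        _ = 0 := by
            rw [integral_sub hi1 hi2]
            linarith
  refine Lp.ext ?_
  filter_upwards [h0, ae_restrict_mem hΩ.isOpen.measurableSet] with x hx hxΩ
  exact sub_eq_zero.1 (hx hxΩ)

lemma MemH1.neg (h : MemH1 Ω u) : MemH1 Ω (-u) := fun i =>
  ⟨_, (h.hasWeakPartial i).neg⟩

lemma MemH1.weakPartial_neg (hΩ : IsLipschitzDomain Ω) (h : MemH1 Ω u) (i : Fin 2) :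
    weakPartial Ω i (-u) = -weakPartial Ω i u :=
  (h.neg.hasWeakPartial i).unique hΩ (h.hasWeakPartial i).neg

end WeakPartial

section Pairing

variable {α : Type*} [MeasurableSpace α] {μ : Measure α}

/-- The pairing `(f, g) ↦ ∫ f g` on `L²`. -/
noncomputable def l2Pairing (μ : Measure α) : Lp ℝ 2 μ →L[ℝ] Lp ℝ 2 μ →L[ℝ] ℝ :=
  (ContinuousLinearMap.mul ℝ ℝ).lpPairing μ 2 2

lemma l2Pairing_apply (f g : Lp ℝ 2 μ) : l2Pairing μ f g = ∫ x, f x * g x ∂μ := by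
  simp [l2Pairing, ContinuousLinearMap.lpPairing_eq_integral]

lemma l2Pairing_comm (f g : Lp ℝ 2 μ) : l2Pairing μ f g = l2Pairing μ g f := by
  simp only [l2Pairing_apply, mul_comm]

lemma tendsto_integral_mul_of_eLpNorm {F G : ℕ → α → ℝ} {f g : α → ℝ} (hF : ∀ k, MemLp (F k) 2 μ)
    (hG : ∀ k, MemLp (G k) 2 μ) (hf : MemLp f 2 μ) (hg : MemLp g 2 μ)
    (hFf : Tendsto (fun k => eLpNorm (fun x => F k x - f x) 2 μ) atTop (𝓝 0))
    (hGg : Tendsto (fun k => eLpNorm (fun x => G k x - g x) 2 μ) atTop (𝓝 0)) :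
    Tendsto (fun k => ∫ x, F k x * G k x ∂μ) atTop (𝓝 (∫ x, f x * g x ∂μ)) := by
  have key : ∀ {a b : α → ℝ} (ha : MemLp a 2 μ) (hb : MemLp b 2 μ),
      l2Pairing μ (ha.toLp a) (hb.toLp b) = ∫ x, a x * b x ∂μ := fun ha hb => by
    rw [l2Pairing_apply]
    refine integral_congr_ae ?_
    filter_upwards [ha.coeFn_toLp, hb.coeFn_toLp] with x h1 h2
    rw [h1, h2]
  have h1 := (Lp.tendsto_Lp_iff_tendsto_eLpNorm'' F hF f hf).2 hFf
  have h2 := (Lp.tendsto_Lp_iff_tendsto_eLpNorm'' G hG g hg).2 hGg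
  have h3 := ((l2Pairing μ).continuous₂.tendsto _).comp (h1.prodMk_nhds h2)
  simpa only [Function.comp_def, Function.uncurry_apply_pair, key] using h3

end Pairing

/-! ### Traces and Green's formula -/

section Trace

variable {Ω : Set Plane} (hΩ : IsLipschitzDomain Ω)
include hΩ

/-- Functions in `H¹(Ω)` have a trace. -/
lemma IsLipschitzDomain.exists_isTrace {u : L2 Ω} (hu : MemH1 Ω u) :
    ∃ g : L2Bdry Ω, IsTrace Ω u g := by
  obtain ⟨U, hU, hU0, hU1⟩ := hΩ.exists_smooth_approx hu.hasWeakPartial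
  obtain ⟨C, hC⟩ := hΩ.exists_eLpNorm_le
  have hU' : ∀ k, ContDiff ℝ 1 (U k) := fun k => (hU k).of_le (by exact_mod_cast le_top)
  have hUb := fun k => hΩ.memLp_bdryMeasure (hU k).continuous 2
  have hUi := fun k => hΩ.memLp_restrict (hU k).continuous 2
  have hdi := fun k i => hΩ.memLp_restrict (continuous_pderiv (hU' k) i) 2
  set A : ℕ → ℝ≥0∞ := fun k => eLpNorm (fun x => U k x - u x) 2 (volume.restrict Ω) +
    ∑ i, eLpNorm (fun x => pderiv i (U k) x - weakPartial Ω i u x) 2 (volume.restrict Ω) with hA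
  have hA0 : Tendsto A atTop (𝓝 0) := by
    have := hU0.add (tendsto_finsetSum Finset.univ fun i _ => hU1 i)
    simp only [Finset.sum_const_zero, add_zero] at this
    exact this
  have htri : ∀ {a b c : Plane → ℝ}, MemLp a 2 (volume.restrict Ω) →
      MemLp b 2 (volume.restrict Ω) → MemLp c 2 (volume.restrict Ω) →
      eLpNorm (fun x => a x - b x) 2 (volume.restrict Ω) ≤
        eLpNorm (fun x => a x - c x) 2 (volume.restrict Ω) +
        eLpNorm (fun x => b x - c x) 2 (volume.restrict Ω) := by
    intro a b c ha hb hc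
    have h1 : (fun x => a x - b x) = (fun x => a x - c x) - fun x => b x - c x := by
      ext x
      simp
    rw [h1]
    exact eLpNorm_sub_le (ha.sub hc).1 (hb.sub hc).1 one_le_two
  -- The trace inequality for `U k - U l` makes the boundary values Cauchy in `L²(∂Ω)`; their limit
  -- is the trace.
  have hbd : ∀ k l, eLpNorm (fun x => U k x - U l x) 2 (bdryMeasure Ω) ≤ C * (A k + A l) := by
    intro k l
    refine (hC (fun x => U k x - U l x) ((hU' k).sub (hU' l))).trans ?_
    gcongr (C : ℝ≥0∞) * ?_
    have hp : ∀ i, pderiv i (fun x => U k x - U l x) =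
        fun x => pderiv i (U k) x - pderiv i (U l) x :=
      fun i => by
        ext x
        simp [pderiv, fderiv_fun_sub ((hU' k).differentiable one_ne_zero x)
          ((hU' l).differentiable one_ne_zero x)]
    simp only [hp]
    calc _ ≤ (eLpNorm (fun x => U k x - u x) 2 (volume.restrict Ω) +
          eLpNorm (fun x => U l x - u x) 2 (volume.restrict Ω)) +
          ∑ i, (eLpNorm (fun x => pderiv i (U k) x - weakPartial Ω i u x) 2 (volume.restrict Ω) +
            eLpNorm (fun x => pderiv i (U l) x - weakPartial Ω i u x) 2 (volume.restrict Ω)) := by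
          gcongr with i
          · exact htri (hUi k) (hUi l) (Lp.memLp u)
          · exact htri (hdi k i) (hdi l i) (Lp.memLp _)
      _ = A k + A l := by
          rw [Finset.sum_add_distrib]
          exact add_add_add_comm _ _ _ _
  have hcau : CauchySeq fun k => (hUb k).toLp (U k) := by
    rw [EMetric.cauchySeq_iff]
    intro ε hε
    have hCA : Tendsto (fun k => (C : ℝ≥0∞) * A k) atTop (𝓝 0) := by
      simpa using ENNReal.Tendsto.const_mul hA0 (Or.inr ENNReal.coe_ne_top)
    obtain ⟨M, hM⟩ := eventually_atTop.1 (hCA.eventually_lt_const (ENNReal.half_pos hε.ne'))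
    refine ⟨M, fun k hk l hl => ?_⟩
    rw [Lp.edist_toLp_toLp]
    refine (hbd k l).trans_lt ?_
    rw [mul_add, ← ENNReal.add_halves ε]
    exact ENNReal.add_lt_add (hM k hk) (hM l hl)
  obtain ⟨g, hg⟩ := cauchySeq_tendsto_of_complete hcau
  refine ⟨g, U, hU, hU0, hU1, ?_⟩
  rw [Lp.tendsto_Lp_iff_tendsto_eLpNorm'] at hg
  refine hg.congr fun k => eLpNorm_congr_ae ?_
  filter_upwards [(hUb k).coeFn_toLp] with x hx
  simp [hx]

lemma IsLipschitzDomain.isTrace_trace {u : L2 Ω} (hu : MemH1 Ω u) : IsTrace Ω u (trace Ω u) := by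
  have h := hΩ.exists_isTrace hu
  rw [trace, dif_pos h]
  exact h.choose_spec

lemma IsLipschitzDomain.memLp_mul_outerNormal {a : Plane → ℝ} (ha : MemLp a 2 (bdryMeasure Ω))
    (i : Fin 2) : MemLp (fun x => a x * outerNormal Ω x i) 2 (bdryMeasure Ω) := by
  refine ha.mono (ha.1.mul ?_) (ae_of_all _ fun x => ?_)
  · exact (EuclideanSpace.proj (𝕜 := ℝ) i).continuous.comp_aestronglyMeasurable
      hΩ.aestronglyMeasurable_outerNormal
  · rw [norm_mul]
    exact mul_le_of_le_one_right (norm_nonneg _)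
      ((PiLp.norm_apply_le _ i).trans (norm_outerNormal_le Ω x))

lemma IsLipschitzDomain.integrable_trace_mul_trace (a b : L2Bdry Ω) (i : Fin 2) :
    Integrable (fun x => a x * (b x * outerNormal Ω x i)) (bdryMeasure Ω) :=
  MemLp.integrable_mul (Lp.memLp a) (hΩ.memLp_mul_outerNormal (Lp.memLp b) i)

/-- Green's formula in `H¹(Ω)`. -/
lemma IsLipschitzDomain.green {u w : L2 Ω} {a b : L2Bdry Ω} (hu : IsTrace Ω u a)
    (hw : IsTrace Ω w b) (i : Fin 2) :
    l2Pairing _ (weakPartial Ω i u) w + l2Pairing _ u (weakPartial Ω i w) =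
      ∫ x, a x * (b x * outerNormal Ω x i) ∂(bdryMeasure Ω) := by
  obtain ⟨U, hU, hU0, hU1, hUb⟩ := hu
  obtain ⟨W, hW, hW0, hW1, hWb⟩ := hw
  have hU' : ∀ k, ContDiff ℝ 1 (U k) := fun k => (hU k).of_le (by exact_mod_cast le_top)
  have hW' : ∀ k, ContDiff ℝ 1 (W k) := fun k => (hW k).of_le (by exact_mod_cast le_top)
  have mU := fun k => hΩ.memLp_restrict (hU k).continuous 2
  have mW := fun k => hΩ.memLp_restrict (hW k).continuous 2
  have mdU := fun k => hΩ.memLp_restrict (continuous_pderiv (hU' k) i) 2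
  have mdW := fun k => hΩ.memLp_restrict (continuous_pderiv (hW' k) i) 2
  have bU := fun k => hΩ.memLp_bdryMeasure (hU k).continuous 2
  have bW := fun k => hΩ.memLp_bdryMeasure (hW k).continuous 2
  have h1 := tendsto_integral_mul_of_eLpNorm mdU mW (Lp.memLp _) (Lp.memLp w) (hU1 i) hW0
  have h2 := tendsto_integral_mul_of_eLpNorm mU mdW (Lp.memLp u) (Lp.memLp _) hU0 (hW1 i)
  have hWn : Tendsto (fun k => eLpNorm
      (fun x => W k x * outerNormal Ω x i - b x * outerNormal Ω x i) 2 (bdryMeasure Ω))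
      atTop (𝓝 0) := by
    refine tendsto_of_tendsto_of_tendsto_of_le_of_le tendsto_const_nhds hWb (fun _ => zero_le)
      fun k => eLpNorm_mono fun x => ?_
    rw [← sub_mul, norm_mul]
    exact mul_le_of_le_one_right (norm_nonneg _)
      ((PiLp.norm_apply_le _ i).trans (norm_outerNormal_le Ω x))
  have h3 := tendsto_integral_mul_of_eLpNorm bU (fun k => hΩ.memLp_mul_outerNormal (bW k) i)
    (Lp.memLp a) (hΩ.memLp_mul_outerNormal (Lp.memLp b) i) hUb hWn
  rw [l2Pairing_apply, l2Pairing_apply]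
  refine tendsto_nhds_unique (h1.add h2) (h3.congr fun k => ?_)
  -- For smooth functions, Green's formula is the divergence theorem for the product; both sides
  -- pass to the limit by continuity of the pairing.
  have h4 := hΩ.integral_fderiv ((hU' k).mul (hW' k)) (EuclideanSpace.single i 1)
  have h5 : ∀ x, fderiv ℝ (fun x => U k x * W k x) x (EuclideanSpace.single i 1) =
      pderiv i (U k) x * W k x + U k x * pderiv i (W k) x := fun x => by
    have := pderiv_mul ((hU' k).differentiable one_ne_zero x)
      ((hW' k).differentiable one_ne_zero x) i
    rw [pderiv] at this
    rw [this]
    ring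
  simp only [h5, EuclideanSpace.inner_single_left, map_one, one_mul] at h4
  have h6 := integral_add (MemLp.integrable_mul (mdU k) (mW k))
    (MemLp.integrable_mul (mU k) (mdW k))
  simp only [Pi.mul_apply] at h6
  rw [← h6, h4]
  simp only [mul_assoc]

end Trace

/-! ### The time derivative of the Hamiltonian -/

section WeightedPairing

variable {α : Type*} [MeasurableSpace α] {μ : Measure α} {m : α → ℝ}

lemma integrable_weight_mul (hm : MemLp m ∞ μ) (f g : Lp ℝ 2 μ) :
    Integrable (fun x => m x * (f x * g x)) μ := by
  have h := MemLp.integrable_mul (Lp.memLp f) (Lp.memLp g)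
  exact memLp_one_iff_integrable.1 ((memLp_one_iff_integrable.2 h).mul (r := 1) hm)

/-- An essentially bounded weight gives a continuous bilinear form on `L²`, to which the product
rule for derivatives applies. -/
lemma exists_weightedPairing (hm : MemLp m ∞ μ) :
    ∃ B : Lp ℝ 2 μ →L[ℝ] Lp ℝ 2 μ →L[ℝ] ℝ, ∀ f g, B f g = ∫ x, m x * (f x * g x) ∂μ := by
  refine ⟨(l2Pairing μ).comp ((ContinuousLinearMap.mul ℝ ℝ).holderL μ ∞ 2 2 (hm.toLp m)),
    fun f g => ?_⟩
  rw [ContinuousLinearMap.comp_apply, l2Pairing_apply]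
  refine integral_congr_ae ?_
  filter_upwards [(ContinuousLinearMap.mul ℝ ℝ).coeFn_holder (r := 2) (hm.toLp m) f,
    hm.coeFn_toLp] with x hx hx'
  change ((ContinuousLinearMap.mul ℝ ℝ).holder 2 (hm.toLp m) f) x * g x = _
  rw [hx, hx', ContinuousLinearMap.mul_apply', mul_assoc]

end WeightedPairing

section Hamiltonian

variable {Ω : Set Plane} {ρ h : Plane → ℝ} {D : Fin 2 → Fin 2 → Fin 2 → Fin 2 → Plane → ℝ}

lemma IsPlateMaterial.memLp_inv (hΩ : IsLipschitzDomain Ω) (hmat : IsPlateMaterial Ω ρ h D) :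
    MemLp (fun x => 1 / (ρ x * h x)) ∞ (volume.restrict Ω) := by
  obtain ⟨c, hc, hcb⟩ := hmat.lower
  refine memLp_top_of_bound ?_ (1 / c) ?_
  · exact ((hmat.rho_meas.mul hmat.h_meas).const_div 1).aestronglyMeasurable
  · filter_upwards [ae_restrict_mem hΩ.isOpen.measurableSet] with x hx
    have h1 := hcb x hx
    rw [Real.norm_of_nonneg (by have := hc.trans_le h1; positivity)]
    gcongr

lemma IsPlateMaterial.memLp_stiffness (hΩ : IsLipschitzDomain Ω) (hmat : IsPlateMaterial Ω ρ h D)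
    (i j k l : Fin 2) : MemLp (D i j k l) ∞ (volume.restrict Ω) := by
  obtain ⟨C, hC⟩ := hmat.D_bdd
  refine memLp_top_of_bound (hmat.D_meas i j k l).aestronglyMeasurable C ?_
  filter_upwards [ae_restrict_mem hΩ.isOpen.measurableSet] with x hx using hC i j k l x hx

/-- Each quadratic term contributes two derivatives, which coincide by symmetry and absorb the
factor `1/2`. No spatial regularity is involved. -/
lemma hasDerivWithinAt_hamiltonian (hΩ : IsLipschitzDomain Ω) (hmat : IsPlateMaterial Ω ρ h D)
    {I : Set ℝ} {t : ℝ} {p : ℝ → L2 Ω} {p' v : L2 Ω} {ε : ℝ → Fin 2 → Fin 2 → L2 Ω}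
    {ε' σ : Fin 2 → Fin 2 → L2 Ω} (hp : HasDerivWithinAt p p' I t)
    (hε : HasDerivWithinAt ε ε' I t)
    (hv : ∀ᵐ x ∂(volume.restrict Ω), v x = 1 / (ρ x * h x) * p t x)
    (hσ : ∀ i j, ∀ᵐ x ∂(volume.restrict Ω), σ i j x = ∑ k, ∑ l, D i j k l x * ε t k l x) :
    HasDerivWithinAt (fun s => hamiltonian Ω ρ h D (p s) (ε s))
      (l2Pairing _ v p' + ∑ i, ∑ j, l2Pairing _ (σ i j) (ε' i j)) I t := by
  have hm := hmat.memLp_inv hΩ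
  have hD := hmat.memLp_stiffness hΩ
  obtain ⟨B, hB⟩ := exists_weightedPairing hm
  choose T hT using fun i j k l => exists_weightedPairing (hD i j k l)
  have hεc : ∀ i j, HasDerivWithinAt (fun s => ε s i j) (ε' i j) I t := fun i j =>
    hasDerivWithinAt_pi.1 (hasDerivWithinAt_pi.1 hε i) j
  have hH : ∀ s, hamiltonian Ω ρ h D (p s) (ε s) =
      (1 / 2) * (B (p s) (p s) + ∑ i, ∑ j, ∑ k, ∑ l, T i j k l (ε s i j) (ε s k l)) := by
    intro s
    have h4 := fun i j k l => integrable_weight_mul (hD i j k l) (ε s i j) (ε s k l)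
    have h3 := fun i j k => integrable_finsetSum Finset.univ fun l _ => h4 i j k l
    have h2 := fun i j => integrable_finsetSum Finset.univ fun k _ => h3 i j k
    have h1 := fun i => integrable_finsetSum Finset.univ fun j _ => h2 i j
    have h0 := integrable_finsetSum Finset.univ fun i _ => h1 i
    rw [hamiltonian, hB]
    simp only [hT]
    simp_rw [← integral_finsetSum Finset.univ fun l _ => h4 _ _ _ l,
      ← integral_finsetSum Finset.univ fun k _ => h3 _ _ k,
      ← integral_finsetSum Finset.univ fun j _ => h2 _ j]
    rw [← integral_finsetSum Finset.univ fun i _ => h1 i,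
      ← integral_add (integrable_weight_mul hm (p s) (p s)) h0]
    congr 2
    ext x
    simp only [Finset.mul_sum, sq]
    congr! 5 with i _ j _ k _ l _
    ring
  simp only [hH]
  have hT' : ∀ i j k l, HasDerivWithinAt (fun s => T i j k l (ε s i j) (ε s k l))
      (T i j k l (ε t i j) (ε' k l) + T i j k l (ε' i j) (ε t k l)) I t := fun i j k l =>
    (T i j k l).hasDerivWithinAt_of_bilinear (hεc i j) (hεc k l)
  refine (((B.hasDerivWithinAt_of_bilinear hp hp).add
    (HasDerivWithinAt.fun_sum fun i _ => HasDerivWithinAt.fun_sum fun j _ =>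
      HasDerivWithinAt.fun_sum fun k _ => HasDerivWithinAt.fun_sum fun l _ =>
        hT' i j k l)).const_mul (1 / 2)).congr_deriv ?_
  have hBp : B (p t) p' = l2Pairing _ v p' := by
    rw [hB, l2Pairing_apply]
    refine integral_congr_ae ?_
    filter_upwards [hv] with x hx
    rw [hx, mul_assoc]
  have hBp' : B p' (p t) = l2Pairing _ v p' := by
    rw [hB, l2Pairing_apply]
    refine integral_congr_ae ?_
    filter_upwards [hv] with x hx
    rw [hx]
    ring
  have hTs : ∀ i j, ∑ k, ∑ l, T i j k l (ε' i j) (ε t k l) = l2Pairing _ (σ i j) (ε' i j) := by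
    intro i j
    have h4 := fun k l => integrable_weight_mul (hD i j k l) (ε' i j) (ε t k l)
    have h3 := fun k => integrable_finsetSum Finset.univ fun l _ => h4 k l
    simp only [hT]
    simp_rw [← integral_finsetSum Finset.univ fun l _ => h4 _ l]
    rw [← integral_finsetSum Finset.univ fun k _ => h3 k, l2Pairing_apply]
    refine integral_congr_ae ?_
    filter_upwards [hσ i j] with x hx
    simp only [hx, Finset.sum_mul]
    congr! 2 with k _ l _
    ring
  -- Major symmetry of `D` exchanges the pairs of indices and so moves the derivative to the first
  -- slot.
  have hTsymm : ∀ i j k l, T i j k l (ε t i j) (ε' k l) = T k l i j (ε' k l) (ε t i j) := by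
    intro i j k l
    rw [hT, hT]
    refine setIntegral_congr_fun hΩ.isOpen.measurableSet fun x hx => ?_
    simp only [hmat.D_major i j k l x hx]
    ring
  have hswap : ∑ i, ∑ j, ∑ k, ∑ l, T i j k l (ε t i j) (ε' k l) =
      ∑ i, ∑ j, l2Pairing _ (σ i j) (ε' i j) := by
    simp only [hTsymm, ← hTs, Fin.sum_univ_two]
    ring
  simp only [Finset.sum_add_distrib]
  rw [hBp, hBp', hswap]
  simp only [hTs]
  ring

end Hamiltonian

/-! ### The power balance -/

section PowerBalance

variable {Ω : Set Plane}

lemma IsLipschitzDomain.integrable_boundaryPower (hΩ : IsLipschitzDomain Ω) (v : L2 Ω)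
    (σ : Fin 2 → Fin 2 → L2 Ω) : Integrable (boundaryPower Ω v σ) (bdryMeasure Ω) ∧
    ∫ x, boundaryPower Ω v σ x ∂(bdryMeasure Ω) =
      -(∑ i, ∫ x, trace Ω v x * (trace Ω (tensorDiv Ω σ i) x * outerNormal Ω x i)
        ∂(bdryMeasure Ω)) +
      ∑ i, ∑ j, ∫ x, trace Ω (grad Ω v i) x * (trace Ω (σ i j) x * outerNormal Ω x j)
        ∂(bdryMeasure Ω) := by
  have h1 := fun i => hΩ.integrable_trace_mul_trace (trace Ω v) (trace Ω (tensorDiv Ω σ i)) i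
  have h2 := fun i j => hΩ.integrable_trace_mul_trace (trace Ω (grad Ω v i)) (trace Ω (σ i j)) j
  have h3 := (integrable_finsetSum Finset.univ fun i _ => h1 i).neg
  have h4 := fun i => integrable_finsetSum Finset.univ fun j _ => h2 i j
  have h5 := integrable_finsetSum Finset.univ fun i _ => h4 i
  have heq : boundaryPower Ω v σ = fun x =>
      (-fun x => ∑ i, trace Ω v x * (trace Ω (tensorDiv Ω σ i) x * outerNormal Ω x i)) x +
      ∑ i, ∑ j, trace Ω (grad Ω v i) x * (trace Ω (σ i j) x * outerNormal Ω x j) := by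
    ext x
    simp only [boundaryPower, Finset.mul_sum, mul_assoc, Pi.neg_apply]
  rw [heq]
  refine ⟨h3.add h5, ?_⟩
  rw [integral_add h3 h5, integral_finsetSum Finset.univ fun i _ => h4 i]
  simp only [Pi.neg_apply]
  rw [integral_neg, integral_finsetSum Finset.univ fun i _ => h1 i]
  simp_rw [integral_finsetSum Finset.univ fun j _ => h2 _ j]

/-- Green's formula is applied to the pairs `(v, -N i)` and `(ω i, σ i j)`. Their interior products
`ω i * N i` occur with opposite signs and cancel. -/
lemma IsLipschitzDomain.integral_boundaryPower (hΩ : IsLipschitzDomain Ω) {v : L2 Ω}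
    {σ : Fin 2 → Fin 2 → L2 Ω} {ω N : Fin 2 → L2 Ω} (hσs : ∀ i j, σ i j = σ j i)
    (hv : MemH1 Ω v) (hσ : ∀ i j, MemH1 Ω (σ i j)) (hω : ∀ i, MemH1 Ω (ω i))
    (hN : ∀ i, MemH1 Ω (N i)) (hNσ : 0 = tensorDiv Ω σ + N) (hωv : 0 = grad Ω v - ω) :
    ∫ x, boundaryPower Ω v σ x ∂(bdryMeasure Ω) =
      l2Pairing _ v (vdiv Ω N) + ∑ i, ∑ j, l2Pairing _ (σ i j) (symGrad Ω ω i j) := by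
  have hgrad : ∀ i, weakPartial Ω i v = ω i := fun i =>
    congrFun (sub_eq_zero.1 hωv.symm) i
  have hgrad' : ∀ i, grad Ω v i = ω i := hgrad
  have hdiv : ∀ i, tensorDiv Ω σ i = -N i := fun i =>
    congrFun (eq_neg_of_add_eq_zero_left hNσ.symm) i
  have hdiv' : ∀ i, weakPartial Ω 0 (σ i 0) + weakPartial Ω 1 (σ i 1) = -N i := fun i => by
    rw [← hdiv, tensorDiv, Fin.sum_univ_two]
  have g1 := fun i => hΩ.green (hΩ.isTrace_trace hv) (hΩ.isTrace_trace (hN i).neg) i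
  have g2 := fun i j => hΩ.green (hΩ.isTrace_trace (hω i)) (hΩ.isTrace_trace (hσ i j)) j
  rw [(hΩ.integrable_boundaryPower v σ).2]
  simp only [hdiv, hgrad', ← g1, ← g2, (hN _).weakPartial_neg hΩ, hgrad]
  -- Summed over columns, the terms with derivatives of `σ` involve only its divergence, even though
  -- single partial derivatives of `σ` have no relation to `N`.
  have e : ∀ i, l2Pairing _ (ω i) (weakPartial Ω 0 (σ i 0)) +
      l2Pairing _ (ω i) (weakPartial Ω 1 (σ i 1)) = -l2Pairing _ (ω i) (N i) := fun i => by
    rw [← map_add, hdiv', map_neg]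
  have e0 := e 0
  have e1 := e 1
  simp only [vdiv, symGrad, Fin.sum_univ_two, map_add, map_smul, map_neg, smul_eq_mul,
    hσs 1 0, l2Pairing_comm (weakPartial Ω _ (ω _)) _] at e0 e1 ⊢
  linarith

end PowerBalance

end KirchhoffLove

theorem mainTheorem5
    (Ω : Set KirchhoffLove.Plane) (hΩ : KirchhoffLove.IsLipschitzDomain Ω)
    (ρ h : KirchhoffLove.Plane → ℝ)
    (D : Fin 2 → Fin 2 → Fin 2 → Fin 2 → KirchhoffLove.Plane → ℝ)
    (hmat : KirchhoffLove.IsPlateMaterial Ω ρ h D)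
    (I : Set ℝ)
    (p : ℝ → KirchhoffLove.L2 Ω) (ε : ℝ → Fin 2 → Fin 2 → KirchhoffLove.L2 Ω)
    (v : ℝ → KirchhoffLove.L2 Ω) (σ : ℝ → Fin 2 → Fin 2 → KirchhoffLove.L2 Ω)
    (ω N : ℝ → Fin 2 → KirchhoffLove.L2 Ω)
    (hsol : KirchhoffLove.IsSolution Ω ρ h D I p ε v σ ω N) :
    ∀ t ∈ I,
      Integrable (KirchhoffLove.boundaryPower Ω (v t) (σ t)) (KirchhoffLove.bdryMeasure Ω) ∧
      HasDerivWithinAt (fun s => KirchhoffLove.hamiltonian Ω ρ h D (p s) (ε s))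
        (∫ x, KirchhoffLove.boundaryPower Ω (v t) (σ t) x ∂(KirchhoffLove.bdryMeasure Ω)) I t := by
  intro t ht
  -- The minor symmetry of `D` in its first two indices passes to `σ`; it is what allows the full
  -- gradient of `ω` to replace the symmetric one.
  have hσs : ∀ i j, σ t i j = σ t j i := fun i j => by
    refine Lp.ext ?_
    filter_upwards [hsol.sigma_eq t ht i j, hsol.sigma_eq t ht j i,
      ae_restrict_mem hΩ.isOpen.measurableSet] with x h1 h2 hx
    rw [h1, h2]
    simp only [hmat.D_minor i j _ _ x hx]
  refine ⟨(hΩ.integrable_boundaryPower (v t) (σ t)).1, ?_⟩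
  rw [hΩ.integral_boundaryPower hσs (hsol.v_mem t ht) (hsol.sigma_mem t ht) (hsol.omega_mem t ht)
    (hsol.N_mem t ht) (hsol.constraint_N t ht) (hsol.constraint_omega t ht)]
  exact KirchhoffLove.hasDerivWithinAt_hamiltonian hΩ hmat (hsol.momentum t ht)
    (hsol.curvature t ht) (hsol.v_eq t ht) (hsol.sigma_eq t ht)
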